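/- Let $G:\mathbb{R}_+\to\mathbb{R}_+$ be a locally integrable, right-continuous function (a kernel) with $G(0)>0$. We say that $G$ preserves nonnegativity if for all $K\ge 1$, $x_1,\dots,x_K\in\mathbb{R}$ and $0\le t_1<\dots<t_K$ such that $\sum_{k'=1}^{k}x_{k'}G(t_k-t_{k'})\ge 0$ for every $k\in\{1,\dots,K\}$, we have $\sum_{k:\,t_k\le t}x_kG(t-t_k)\ge 0$ for all $t\ge 0$. A resolvent of the first kind of $G$ is a signed Borel measure $R$ on $\mathbb{R}_+$ with locally bounded total variation such that, for every $t\ge 0$, the integral $\int_{[0,t]}G(t-s)\,R(ds)$ converges absolutely and equals $1$. Such an $R$ is called nonincreasing if for all $0\le h_1\le h_2$, $R(h_1+ds)-R(h_2+ds)$ is a nonnegative measure on $\mathbb{R}_+$, where $R(h+ds)$ denotes the image of $R$ under $s\mapsto s-h$, restricted to $\mathbb{R}_+$. (1) If $G$ has a resolvent of the first kind $R$ and $R$ is nonincreasing, then $G$ preserves nonnegativity. (2) Assume moreover that $G$ is nonincreasing. Then $G$ has a unique resolvent of the first kind $R$, and $G$ preserves nonnegativity if and only if $R$ is nonincreasing.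 Besides, in this case $$R(ds)=\frac{1}{G(0)}\,\delta_0(ds)+r(s)\,ds,$$ where $r:(0,\infty)\to\mathbb{R}_+$ is a nonincreasing function that is integrable on $(0,T]$ for every $T>0$. -/

import Mathlib

open MeasureTheory Set

/-- A kernel `G` on `[0, ∞)` (only the values of `G` on `[0, ∞)` are used) preserves nonnegativity:
for all weights `x` and times `0 ≤ t 0 < t 1 < ...`, if the sums are nonnegative at each of the
times, then they are nonnegative at every time `s ≥ 0`. -/
def PreservesNonneg (G : ℝ → ℝ) : Prop :=
  ∀ (K : ℕ) (x t : Fin K → ℝ), (∀ k, 0 ≤ t k) → StrictMono t →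
    (∀ k, 0 ≤ ∑ k' ∈ Finset.univ.filter (fun k' => k' ≤ k), x k' * G (t k - t k')) →
    ∀ s : ℝ, 0 ≤ s → 0 ≤ ∑ k ∈ Finset.univ.filter (fun k => t k ≤ s), x k * G (s - t k)

/-- A signed Borel measure on `[0, ∞)` with locally bounded total variation, given by its Jordan
decomposition: two mutually singular Borel measures, carried by `[0, ∞)` and finite on each
`[0, T]`. -/
@[ext]
structure LocSignedMeasure where
  /-- the positive part -/
  pos : Measure ℝ
  /-- the negative part -/
  neg : Measure ℝ
  pos_Iio : pos (Iio 0) = 0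
  neg_Iio : neg (Iio 0) = 0
  pos_finite : ∀ T : ℝ, pos (Icc 0 T) < ⊤
  neg_finite : ∀ T : ℝ, neg (Icc 0 T) < ⊤
  singular : pos.MutuallySingular neg

namespace LocSignedMeasure

/-- The total variation measure `|R|`. -/
noncomputable def totalVariation (R : LocSignedMeasure) : Measure ℝ := R.pos + R.neg

/-- The value `R(A)` on a bounded Borel set `A`. -/
noncomputable def eval (R : LocSignedMeasure) (A : Set ℝ) : ℝ :=
  (R.pos A).toReal - (R.neg A).toReal

/-- The integral of `f` over `A` against `R` (for `f` integrable on `A` against `|R|`). -/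
noncomputable def setIntegral (R : LocSignedMeasure) (A : Set ℝ) (f : ℝ → ℝ) : ℝ :=
  (∫ s in A, f s ∂(R.pos)) - ∫ s in A, f s ∂(R.neg)

/-- `R` is nonincreasing: for `0 ≤ h₁ ≤ h₂`, `R(h₁ + ds) - R(h₂ + ds)` is a nonnegative measure
on `[0, ∞)`, where `R(h + ds)` is the image of `R` under `s ↦ s - h`; that is, the difference is
nonnegative on all bounded Borel subsets of `[0, ∞)`. -/
def Nonincreasing (R : LocSignedMeasure) : Prop :=
  ∀ h₁ h₂ : ℝ, 0 ≤ h₁ → h₁ ≤ h₂ → ∀ (T : ℝ) (A : Set ℝ), MeasurableSet A → A ⊆ Icc 0 T →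
    0 ≤ R.eval ((fun s => s - h₁) ⁻¹' A) - R.eval ((fun s => s - h₂) ⁻¹' A)

/-- `R` is a resolvent of the first kind of `G`: for every `t ≥ 0` the integral
`∫_{[0,t]} G(t - s) R(ds)` converges absolutely and equals `1`. -/
def IsResolvent (R : LocSignedMeasure) (G : ℝ → ℝ) : Prop :=
  ∀ t : ℝ, 0 ≤ t →
    IntegrableOn (fun s => G (t - s)) (Icc 0 t) R.totalVariation ∧
      R.setIntegral (Icc 0 t) (fun s => G (t - s)) = 1

end LocSignedMeasure

/-! Write `γ` for the measure `G ds` on `[0, ∞)` and `λ` for Lebesgue measure there. The resolvent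
equation says `γ * R = λ`. To avoid subtracting infinite quantities it is used as `γ * R⁺ = λ + γ *
R⁻`, an identity between positive measures finite on bounded sets, where equal summands can be
cancelled. Since convolution with `λ` is injective (it produces the distribution function as a
density), `R` is unique.

A nonincreasing resolvent is sufficient. Let `f = ∑ x_k G(· - t_k)`, with `G` extended by zero. Then
`f * R = ∑ x_k 1_{· ≥ t_k}` is constant after the last time `T`. By induction on `K`, `f ≥ 0` up to
`T`. Cut `f = p + q` at `T`: because `R` is nonincreasing, `p * R` is nonincreasing on `[T, ∞)`, so
`q * R` is nondecreasing there. Convolving with `G` gives `q * λ = (q * R) * G`, again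
nondecreasing, so the right-continuous `q` is nonnegative.

For nonincreasing `G`, existence is renewal theory: `1 - G/G(0)` is the distribution function of a
measure `ν` of mass at most `1` without mass at `0`, and `R = G(0)⁻¹ ∑ ν^{*n}`, a positive measure.

For necessity, sample `G` on a grid of step `ε`. Using the convolution inverse `a` of the samples as
weights makes all the sums on the grid `1` or `0`, and preservation of nonnegativity forces `a_k ≤
0` for `k ≥ 1`. Hence the partial sums `r_k` of `a`, which form the discrete resolvent, are
nonincreasing. Their cumulative sums approximate `R([0, t])` as `ε → 0`, so this function of `t` is
concave. Its right derivative is the density, and the resolvent equation at `t = 0` gives the atom.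
-/

open Filter Topology ENNReal

/-! ### Measures on the half-line and their convolutions -/

/-- A Borel measure on `ℝ` carried by `[0, ∞)` and finite on bounded sets. -/
class IsHalfLineMeasure (μ : Measure ℝ) : Prop where
  Iio_eq_zero : μ (Iio 0) = 0
  Iic_lt_top : ∀ T : ℝ, μ (Iic T) < ⊤

namespace IsHalfLineMeasure

instance (μ : Measure ℝ) [h : IsHalfLineMeasure μ] : IsLocallyFiniteMeasure μ :=
  ⟨fun x => ⟨Iic (x + 1), Iic_mem_nhds (by linarith), h.Iic_lt_top _⟩⟩

lemma ae_nonneg (μ : Measure ℝ) [h : IsHalfLineMeasure μ] : ∀ᵐ s ∂μ, 0 ≤ s := by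
  rw [ae_iff]
  convert h.Iio_eq_zero using 2
  ext; simp

lemma of_Icc {μ : Measure ℝ} (h0 : μ (Iio 0) = 0) (h : ∀ T : ℝ, μ (Icc 0 T) < ⊤) :
    IsHalfLineMeasure μ := by
  refine ⟨h0, fun T => ?_⟩
  have : Iic T ⊆ Iio 0 ∪ Icc 0 T := fun x hx => by
    rcases lt_or_ge x 0 with h | h
    · exact Or.inl h
    · exact Or.inr ⟨h, hx⟩
  exact (measure_mono this).trans_lt ((measure_union_le _ _).trans_lt (by simp [h0, h T]))

instance (μ ν : Measure ℝ) [hμ : IsHalfLineMeasure μ] [hν : IsHalfLineMeasure ν] :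
    IsHalfLineMeasure (μ + ν) :=
  ⟨by simp [hμ.Iio_eq_zero, hν.Iio_eq_zero],
    fun T => by simpa using ⟨hμ.Iic_lt_top T, hν.Iic_lt_top T⟩⟩

lemma conv_Iic (μ ν : Measure ℝ) [SFinite μ] [SFinite ν] (T : ℝ) :
    (μ.conv ν) (Iic T) = ∫⁻ s, ν (Iic (T - s)) ∂μ := by
  rw [← lintegral_indicator_one measurableSet_Iic,
    Measure.lintegral_conv (measurable_one.indicator measurableSet_Iic)]
  refine lintegral_congr fun s => ?_
  rw [← lintegral_indicator_one measurableSet_Iic]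
  refine lintegral_congr fun y => ?_
  simp only [indicator, mem_Iic, Pi.one_apply]
  congr 1
  rw [eq_iff_iff]
  constructor <;> intro h <;> linarith

instance (μ ν : Measure ℝ) [hμ : IsHalfLineMeasure μ] [hν : IsHalfLineMeasure ν] :
    IsHalfLineMeasure (μ.conv ν) := by
  constructor
  · rw [← lintegral_indicator_one measurableSet_Iio,
      Measure.lintegral_conv (measurable_one.indicator measurableSet_Iio)]
    rw [lintegral_eq_zero_iff' (by fun_prop (disch := measurability))]
    filter_upwards [ae_nonneg μ] with x hx
    simp only [Pi.zero_apply]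
    rw [lintegral_eq_zero_iff' (by fun_prop (disch := measurability))]
    filter_upwards [ae_nonneg ν] with y hy
    simp only [indicator, mem_Iio, Pi.one_apply, Pi.zero_apply]
    rw [if_neg (by linarith)]
  · intro T
    rw [conv_Iic]
    calc ∫⁻ s, ν (Iic (T - s)) ∂μ ≤ ∫⁻ s, (Iic T).indicator (fun _ => ν (Iic T)) s ∂μ := by
          refine lintegral_mono_ae ?_
          filter_upwards [ae_nonneg μ] with s hs
          by_cases hT : s ≤ T
          · rw [indicator_of_mem (by exact hT)]
            exact measure_mono (Iic_subset_Iic.2 (by linarith))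
          · rw [indicator_of_notMem (by exact hT)]
            refine (measure_mono_null ?_ hν.Iio_eq_zero).le
            intro y hy
            simp only [mem_Iic, mem_Iio] at *
            linarith
      _ = ν (Iic T) * μ (Iic T) := by
          rw [lintegral_indicator measurableSet_Iic]; simp
      _ < ⊤ := ENNReal.mul_lt_top (hν.Iic_lt_top T) (hμ.Iic_lt_top T)

lemma ext_Iic {μ ν : Measure ℝ} [hμ : IsHalfLineMeasure μ] [hν : IsHalfLineMeasure ν]
    (h : ∀ T : ℝ, 0 ≤ T → μ (Iic T) = ν (Iic T)) : μ = ν := by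
  have h' : ∀ T : ℝ, μ (Iic T) = ν (Iic T) := fun T => by
    rcases le_or_gt 0 T with hT | hT
    · exact h T hT
    · rw [measure_mono_null (Iic_subset_Iio.2 hT) hμ.Iio_eq_zero,
        measure_mono_null (Iic_subset_Iio.2 hT) hν.Iio_eq_zero]
  refine Measure.ext_of_Ioc μ ν fun a b hab => ?_
  rw [← Iic_sdiff_Iic, measure_sdiff (Iic_subset_Iic.2 hab.le)
    measurableSet_Iic.nullMeasurableSet (hμ.Iic_lt_top a).ne,
    measure_sdiff (Iic_subset_Iic.2 hab.le)
    measurableSet_Iic.nullMeasurableSet (hν.Iic_lt_top a).ne, h', h']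

/-- Local finiteness is what permits cancellation; this replaces subtraction of signed measures
throughout. -/
lemma add_left_cancel {α β β' : Measure ℝ} [hα : IsHalfLineMeasure α] [IsHalfLineMeasure β]
    [IsHalfLineMeasure β'] (h : α + β = α + β') : β = β' := by
  refine ext_Iic fun T _ => ?_
  have := congrArg (fun m : Measure ℝ => m (Iic T)) h
  simp only [Measure.add_apply] at this
  exact (ENNReal.add_right_inj (hα.Iic_lt_top T).ne).1 this

/-- The distribution function of a half-line measure is right-continuous. -/
lemma continuousWithinAt_Iic (μ : Measure ℝ) [hμ : IsHalfLineMeasure μ] (t : ℝ) :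
    ContinuousWithinAt (fun x => μ (Iic x)) (Ici t) t := by
  have h1 := tendsto_measure_biInter_gt (μ := μ) (s := fun x => Iic x) (a := t)
    (fun r _ => measurableSet_Iic.nullMeasurableSet) (fun i j _ hij => Iic_subset_Iic.2 hij)
    ⟨t + 1, by linarith, (hμ.Iic_lt_top _).ne⟩
  have h2 : ⋂ r, ⋂ (_ : r > t), Iic r = Iic t := by
    ext x
    simp only [mem_iInter, mem_Iic]
    exact ⟨fun h => le_of_forall_gt_imp_ge_of_dense h, fun h r hr => h.trans hr.le⟩
  rw [h2] at h1
  rw [← continuousWithinAt_Ioi_iff_Ici]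
  exact h1

end IsHalfLineMeasure

/-! ### Convolution with densities; right-continuous functions -/

/-- Lebesgue measure on `[0, ∞)`. -/
noncomputable def halfLebesgue : Measure ℝ := volume.withDensity ((Ici 0).indicator 1)

lemma withDensity_conv {f : ℝ → ℝ≥0∞} (hf : Measurable f) (μ : Measure ℝ) [SFinite μ] :
    (volume.withDensity f).conv μ = volume.withDensity (fun t => ∫⁻ s, f (t - s) ∂μ) := by
  ext A hA
  rw [← lintegral_indicator_one hA, Measure.lintegral_conv (measurable_one.indicator hA),
    lintegral_withDensity_eq_lintegral_mul _ hf
      (Measurable.lintegral_prod_right (by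
        exact (measurable_one.indicator hA).comp (measurable_fst.add measurable_snd))),
    withDensity_apply _ hA]
  simp only [Pi.mul_apply]
  calc ∫⁻ x, f x * ∫⁻ y, A.indicator 1 (x + y) ∂μ
      = ∫⁻ x, ∫⁻ y, f x * A.indicator 1 (x + y) ∂μ := by
        refine lintegral_congr fun x => (lintegral_const_mul _ ?_).symm
        exact (measurable_one.indicator hA).comp (measurable_const.add measurable_id)
    _ = ∫⁻ y, (∫⁻ x, f x * A.indicator 1 (x + y)) ∂μ := by
        rw [lintegral_lintegral_swap]
        exact ((hf.comp measurable_fst).mul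
          ((measurable_one.indicator hA).comp (measurable_fst.add measurable_snd))).aemeasurable
    _ = ∫⁻ y, (∫⁻ t, f (t - y) * A.indicator 1 t) ∂μ := by
        refine lintegral_congr fun y => ?_
        rw [← lintegral_add_right_eq_self (fun t => f (t - y) * A.indicator 1 t) y]
        simp
    _ = ∫⁻ t, ∫⁻ y, f (t - y) * A.indicator 1 t ∂μ := by
        rw [lintegral_lintegral_swap]
        exact ((hf.comp (measurable_snd.sub measurable_fst)).mul
          ((measurable_one.indicator hA).comp measurable_snd)).aemeasurable
    _ = ∫⁻ t in A, ∫⁻ s, f (t - s) ∂μ := by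
        rw [← lintegral_indicator hA]
        refine lintegral_congr fun t => ?_
        by_cases ht : t ∈ A <;> simp [ht]

lemma isHalfLineMeasure_withDensity {f : ℝ → ℝ≥0∞} (h0 : ∀ t < 0, f t = 0)
    (h : ∀ T : ℝ, ∫⁻ t in Iic T, f t < ⊤) : IsHalfLineMeasure (volume.withDensity f) := by
  constructor
  · rw [withDensity_apply _ measurableSet_Iio, setLIntegral_congr_fun measurableSet_Iio
      (g := fun _ => 0) (fun t ht => h0 t ht)]
    simp
  · intro T
    rw [withDensity_apply _ measurableSet_Iic]
    exact h T

instance : IsHalfLineMeasure halfLebesgue := by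
  refine isHalfLineMeasure_withDensity (fun t ht => by simp [ht]) fun T => ?_
  rw [lintegral_indicator_one measurableSet_Ici, Measure.restrict_apply measurableSet_Ici,
    Ici_inter_Iic]
  simp

lemma halfLebesgue_conv (μ : Measure ℝ) [SFinite μ] :
    halfLebesgue.conv μ = volume.withDensity (fun t => μ (Iic t)) := by
  rw [halfLebesgue, withDensity_conv (measurable_one.indicator measurableSet_Ici)]
  congr 1
  ext t
  rw [← lintegral_indicator_one measurableSet_Iic]
  refine lintegral_congr fun s => ?_
  simp [indicator]

/-- A full-measure subset of the line meets every right neighbourhood. -/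
lemma exists_seq_tendsto_of_ae {p : ℝ → Prop} (h : ∀ᵐ t, p t) (t : ℝ) :
    ∃ u : ℕ → ℝ, (∀ n, p (u n)) ∧ (∀ n, t < u n) ∧ Tendsto u atTop (𝓝[≥] t) := by
  have key : ∀ n : ℕ, ∃ x ∈ Ioo t (t + 1 / ((n : ℝ) + 1)), p x := by
    intro n
    have hd : Dense {x | p x} := Measure.dense_of_ae h
    obtain ⟨x, hx, hx'⟩ := hd.exists_mem_open (isOpen_Ioo (a := t) (b := t + 1 / ((n : ℝ) + 1)))
      (nonempty_Ioo.2 (by linarith [Nat.one_div_pos_of_nat (α := ℝ) (n := n)]))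
    exact ⟨x, hx', hx⟩
  choose u hu hp using key
  refine ⟨u, hp, fun n => (hu n).1, tendsto_nhdsWithin_iff.2 ⟨?_, .of_forall fun n => (hu n).1.le⟩⟩
  refine tendsto_of_tendsto_of_tendsto_of_le_of_le tendsto_const_nhds ?_
    (fun n => (hu n).1.le) (fun n => (hu n).2.le)
  simpa using tendsto_const_nhds.add (tendsto_one_div_add_atTop_nhds_zero_nat (𝕜 := ℝ))

/-- The two convolutions have the distribution functions as densities. These agree almost
everywhere, hence everywhere by right-continuity. -/
lemma halfLebesgue_conv_injective {μ ν : Measure ℝ} [hμ : IsHalfLineMeasure μ]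
    [hν : IsHalfLineMeasure ν] (h : halfLebesgue.conv μ = halfLebesgue.conv ν) : μ = ν := by
  rw [halfLebesgue_conv, halfLebesgue_conv, withDensity_eq_iff_of_sigmaFinite] at h
  · refine IsHalfLineMeasure.ext_Iic fun T _ => ?_
    obtain ⟨u, hu, -, hlim⟩ := exists_seq_tendsto_of_ae h T
    refine tendsto_nhds_unique ((IsHalfLineMeasure.continuousWithinAt_Iic μ T).tendsto.comp hlim) ?_
    refine ((IsHalfLineMeasure.continuousWithinAt_Iic ν T).tendsto.comp hlim).congr fun n => ?_
    exact (hu n).symm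
  · exact (Monotone.measurable fun a b hab => measure_mono (Iic_subset_Iic.2 hab)).aemeasurable
  · exact (Monotone.measurable fun a b hab => measure_mono (Iic_subset_Iic.2 hab)).aemeasurable

/-- A function on the line that is right-continuous everywhere is Borel measurable. -/
lemma measurable_of_rightContinuous {f : ℝ → ℝ} (hf : ∀ t, ContinuousWithinAt f (Ici t) t) :
    Measurable f := by
  -- Rounding up to a grid point strictly to the right of `x` makes `f` a pointwise limit of
  -- functions of the integer floor alone.
  have hlim : ∀ x : ℝ, Tendsto (fun n : ℕ => ((⌊((n : ℝ) + 1) * x⌋ + 1 : ℤ) : ℝ) / ((n : ℝ) + 1))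
      atTop (𝓝[≥] x) := by
    intro x
    have hb : ∀ n : ℕ, x ≤ ((⌊((n : ℝ) + 1) * x⌋ + 1 : ℤ) : ℝ) / ((n : ℝ) + 1) ∧
        ((⌊((n : ℝ) + 1) * x⌋ + 1 : ℤ) : ℝ) / ((n : ℝ) + 1) ≤ x + 1 / ((n : ℝ) + 1) := by
      intro n
      have hn : (0 : ℝ) < (n : ℝ) + 1 := by positivity
      have h1 := Int.floor_le (((n : ℝ) + 1) * x)
      have h2 := Int.lt_floor_add_one (((n : ℝ) + 1) * x)
      push_cast
      rw [le_div_iff₀ hn, div_le_iff₀ hn]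
      constructor
      · linarith
      · field_simp
        linarith
    refine tendsto_nhdsWithin_iff.2 ⟨?_, .of_forall fun n => (hb n).1⟩
    refine tendsto_of_tendsto_of_tendsto_of_le_of_le tendsto_const_nhds ?_
      (fun n => (hb n).1) (fun n => (hb n).2)
    simpa using tendsto_const_nhds.add (tendsto_one_div_add_atTop_nhds_zero_nat (𝕜 := ℝ))
  refine measurable_of_tendsto_metrizable (fun n => ?_)
    (tendsto_pi_nhds.2 fun x => (hf x).tendsto.comp (hlim x))
  have : Measurable (fun k : ℤ => f (((k + 1 : ℤ) : ℝ) / ((n : ℝ) + 1))) := measurable_of_countable _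
  exact this.comp (Int.measurable_floor.comp (measurable_const.mul measurable_id))

namespace LocSignedMeasure

instance (R : LocSignedMeasure) : IsHalfLineMeasure R.pos := .of_Icc R.pos_Iio R.pos_finite

instance (R : LocSignedMeasure) : IsHalfLineMeasure R.neg := .of_Icc R.neg_Iio R.neg_finite

end LocSignedMeasure

/-! ### Kernels extended by zero -/

/-- The extension of a kernel by zero to the negative half-line. -/
noncomputable def zeroExt (G : ℝ → ℝ) : ℝ → ℝ := (Ici 0).indicator G

lemma zeroExt_of_nonneg (G : ℝ → ℝ) {t : ℝ} (ht : 0 ≤ t) : zeroExt G t = G t :=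
  indicator_of_mem (by exact ht) G

lemma zeroExt_of_neg (G : ℝ → ℝ) {t : ℝ} (ht : t < 0) : zeroExt G t = 0 :=
  indicator_of_notMem (by simpa using ht) G

lemma zeroExt_nonneg {G : ℝ → ℝ} (hG : ∀ t : ℝ, 0 ≤ t → 0 ≤ G t) (t : ℝ) : 0 ≤ zeroExt G t :=
  indicator_nonneg (fun x hx => hG x hx) t

lemma continuousWithinAt_zeroExt {G : ℝ → ℝ}
    (hG : ∀ t : ℝ, 0 ≤ t → ContinuousWithinAt G (Ici t) t) (t : ℝ) :
    ContinuousWithinAt (zeroExt G) (Ici t) t := by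
  rcases le_or_gt 0 t with ht | ht
  · exact (hG t ht).congr (fun y hy => zeroExt_of_nonneg G (ht.trans hy)) (zeroExt_of_nonneg G ht)
  · have : zeroExt G =ᶠ[𝓝 t] fun _ => 0 := by
      filter_upwards [Iio_mem_nhds ht] with y hy using zeroExt_of_neg G hy
    exact (continuousAt_const.congr this.symm).continuousWithinAt

lemma measurable_zeroExt {G : ℝ → ℝ}
    (hG : ∀ t : ℝ, 0 ≤ t → ContinuousWithinAt G (Ici t) t) : Measurable (zeroExt G) :=
  measurable_of_rightContinuous (continuousWithinAt_zeroExt hG)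

lemma integrableOn_Iic_zeroExt {G : ℝ → ℝ} (hG : LocallyIntegrableOn G (Ici 0)) (T : ℝ) :
    IntegrableOn (zeroExt G) (Iic T) := by
  rw [IntegrableOn, zeroExt, integrable_indicator_iff measurableSet_Ici, IntegrableOn,
    Measure.restrict_restrict measurableSet_Ici, Ici_inter_Iic]
  exact hG.integrableOn_compact_subset Icc_subset_Ici_self isCompact_Icc

/-- The measure with density `G` on `[0, ∞)`. -/
noncomputable def kernelMeasure (G : ℝ → ℝ) : Measure ℝ :=
  volume.withDensity (fun t => ENNReal.ofReal (zeroExt G t))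

lemma isHalfLineMeasure_withDensity_ofReal {f : ℝ → ℝ} (h0 : ∀ t < 0, f t = 0)
    (h : ∀ T : ℝ, IntegrableOn f (Iic T)) :
    IsHalfLineMeasure (volume.withDensity fun t => ENNReal.ofReal (f t)) := by
  refine isHalfLineMeasure_withDensity (fun t ht => by simp [h0 t ht]) fun T => ?_
  exact (lintegral_mono fun t => Real.ofReal_le_enorm (f t)).trans_lt (h T).2

lemma isHalfLineMeasure_kernelMeasure {G : ℝ → ℝ} (hG : LocallyIntegrableOn G (Ici 0)) :
    IsHalfLineMeasure (kernelMeasure G) :=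
  isHalfLineMeasure_withDensity_ofReal (fun _ ht => zeroExt_of_neg G ht)
    (integrableOn_Iic_zeroExt hG)

lemma Icc_ae_eq_Iic (μ : Measure ℝ) [IsHalfLineMeasure μ] (t : ℝ) :
    (Icc 0 t : Set ℝ) =ᵐ[μ] Iic t := by
  filter_upwards [IsHalfLineMeasure.ae_nonneg μ] with s hs
  exact propext ⟨fun h => h.2, fun h => ⟨hs, h⟩⟩

lemma zeroExt_comp_sub (G : ℝ → ℝ) (t : ℝ) :
    (fun s => zeroExt G (t - s)) = (Iic t).indicator (fun s => G (t - s)) := by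
  ext s
  by_cases h : s ≤ t
  · rw [indicator_of_mem (by exact h), zeroExt_of_nonneg G (by linarith)]
  · rw [indicator_of_notMem (by exact h), zeroExt_of_neg G (by linarith)]

lemma integrable_zeroExt_iff (μ : Measure ℝ) [IsHalfLineMeasure μ] (G : ℝ → ℝ) (t : ℝ) :
    Integrable (fun s => zeroExt G (t - s)) μ ↔ IntegrableOn (fun s => G (t - s)) (Icc 0 t) μ := by
  rw [zeroExt_comp_sub, integrable_indicator_iff measurableSet_Iic,
    integrableOn_congr_set_ae (Icc_ae_eq_Iic μ t)]

lemma integral_zeroExt (μ : Measure ℝ) [IsHalfLineMeasure μ] (G : ℝ → ℝ) (t : ℝ) :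
    ∫ s, zeroExt G (t - s) ∂μ = ∫ s in Icc 0 t, G (t - s) ∂μ := by
  rw [zeroExt_comp_sub, integral_indicator measurableSet_Iic,
    setIntegral_congr_set (Icc_ae_eq_Iic μ t)]

/-! ### The resolvent equation and uniqueness -/

namespace LocSignedMeasure

variable {R : LocSignedMeasure} {G : ℝ → ℝ}

lemma IsResolvent.integrable_pos (h : R.IsResolvent G) (t : ℝ) :
    Integrable (fun s => zeroExt G (t - s)) R.pos := by
  rw [integrable_zeroExt_iff]
  rcases le_or_gt 0 t with ht | ht
  · exact (h t ht).1.mono_measure (Measure.le_add_right le_rfl)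
  · simp [Icc_eq_empty_of_lt ht]

lemma IsResolvent.integrable_neg (h : R.IsResolvent G) (t : ℝ) :
    Integrable (fun s => zeroExt G (t - s)) R.neg := by
  rw [integrable_zeroExt_iff]
  rcases le_or_gt 0 t with ht | ht
  · exact (h t ht).1.mono_measure (Measure.le_add_left le_rfl)
  · simp [Icc_eq_empty_of_lt ht]

lemma IsResolvent.integral_sub (h : R.IsResolvent G) (t : ℝ) :
    (∫ s, zeroExt G (t - s) ∂(R.pos)) - ∫ s, zeroExt G (t - s) ∂(R.neg)
      = (Ici (0 : ℝ)).indicator 1 t := by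
  rw [integral_zeroExt, integral_zeroExt]
  rcases le_or_gt 0 t with ht | ht
  · rw [indicator_of_mem (by exact ht)]
    exact (h t ht).2
  · simp [ht]

lemma IsResolvent.lintegral_pos (h : R.IsResolvent G) (hG : ∀ t : ℝ, 0 ≤ t → 0 ≤ G t) (t : ℝ) :
    ∫⁻ s, ENNReal.ofReal (zeroExt G (t - s)) ∂(R.pos)
      = (Ici (0 : ℝ)).indicator 1 t + ∫⁻ s, ENNReal.ofReal (zeroExt G (t - s)) ∂(R.neg) := by
  rw [← ofReal_integral_eq_lintegral_ofReal (h.integrable_pos t)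
      (.of_forall fun s => zeroExt_nonneg hG _),
    ← ofReal_integral_eq_lintegral_ofReal (h.integrable_neg t)
      (.of_forall fun s => zeroExt_nonneg hG _), ← sub_add_cancel (∫ s, zeroExt G (t - s) ∂(R.pos))
      (∫ s, zeroExt G (t - s) ∂(R.neg)), h.integral_sub,
      ENNReal.ofReal_add (indicator_nonneg (f := (1 : ℝ → ℝ)) (fun _ _ => zero_le_one) _)
      (integral_nonneg fun s => zeroExt_nonneg hG _)]
  congr 1
  by_cases ht : 0 ≤ t <;> simp [indicator, ht]

/-- The resolvent identity as an identity between convolutions of measures. -/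
lemma IsResolvent.kernelMeasure_conv_pos (h : R.IsResolvent G) (hG : ∀ t : ℝ, 0 ≤ t → 0 ≤ G t)
    (hGm : Measurable (zeroExt G)) :
    (kernelMeasure G).conv R.pos = halfLebesgue + (kernelMeasure G).conv R.neg := by
  rw [kernelMeasure, withDensity_conv hGm.ennreal_ofReal, withDensity_conv hGm.ennreal_ofReal,
    halfLebesgue, ← withDensity_add_left (measurable_one.indicator measurableSet_Ici)]
  congr 1
  ext t
  exact h.lintegral_pos hG t

/-- This is the minimality of the Jordan decomposition: off a set that is null for `R.pos`, `R.neg`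
vanishes, and there `R.pos ≤ R.pos + S.neg = S.pos`. -/
lemma pos_le_of_add_eq {R S : LocSignedMeasure} (h : R.pos + S.neg = S.pos + R.neg) :
    R.pos ≤ S.pos := by
  obtain ⟨A, hA, h1, h2⟩ := R.singular
  refine Measure.le_iff.2 fun B hB => ?_
  calc R.pos B ≤ R.pos (A ∪ (B ∩ Aᶜ)) := measure_mono fun x hx => by
          by_cases hxA : x ∈ A
          · exact Or.inl hxA
          · exact Or.inr ⟨hx, hxA⟩
    _ ≤ R.pos A + R.pos (B ∩ Aᶜ) := measure_union_le _ _
    _ = R.pos (B ∩ Aᶜ) := by rw [h1, zero_add]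
    _ ≤ (R.pos + S.neg) (B ∩ Aᶜ) := by simp
    _ = S.pos (B ∩ Aᶜ) := by
        rw [h, Measure.add_apply, measure_mono_null inter_subset_right h2, add_zero]
    _ ≤ S.pos B := measure_mono inter_subset_left

lemma eq_of_add_eq {R S : LocSignedMeasure} (h : R.pos + S.neg = S.pos + R.neg) : R = S := by
  have hp : R.pos = S.pos := le_antisymm (pos_le_of_add_eq h) (pos_le_of_add_eq h.symm)
  rw [hp] at h
  exact LocSignedMeasure.ext hp (IsHalfLineMeasure.add_left_cancel h).symm

/-- A kernel has at most one resolvent of the first kind. -/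
lemma IsResolvent.unique {S : LocSignedMeasure} (hR : R.IsResolvent G) (hS : S.IsResolvent G)
    (hG : ∀ t : ℝ, 0 ≤ t → 0 ≤ G t) (hGm : Measurable (zeroExt G))
    (hGi : LocallyIntegrableOn G (Ici 0)) : R = S := by
  have := isHalfLineMeasure_kernelMeasure hGi
  set γ := kernelMeasure G
  have h1 : γ.conv R.pos = halfLebesgue + γ.conv R.neg := hR.kernelMeasure_conv_pos hG hGm
  have h2 : γ.conv S.pos = halfLebesgue + γ.conv S.neg := hS.kernelMeasure_conv_pos hG hGm
  have h3 : γ.conv (R.pos + S.neg) = γ.conv (S.pos + R.neg) := by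
    rw [Measure.conv_add, Measure.conv_add, h1, h2]
    abel
  refine eq_of_add_eq (halfLebesgue_conv_injective ?_)
  -- Formally, `γ * X = γ * Y` is convolved with `R` to get `λ * X = λ * Y`. Here it is convolved
  -- with `R.pos`, and the common term `R.neg * γ * X = R.neg * γ * Y` is cancelled.
  refine IsHalfLineMeasure.add_left_cancel
    (α := R.neg.conv (γ.conv (R.pos + S.neg))) ?_
  calc R.neg.conv (γ.conv (R.pos + S.neg)) + halfLebesgue.conv (R.pos + S.neg)
      = (γ.conv R.neg).conv (R.pos + S.neg) + halfLebesgue.conv (R.pos + S.neg) := by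
        rw [← Measure.conv_assoc, Measure.conv_comm R.neg γ]
    _ = (halfLebesgue + γ.conv R.neg).conv (R.pos + S.neg) := by
        rw [Measure.add_conv, add_comm]
    _ = R.pos.conv (γ.conv (R.pos + S.neg)) := by
        rw [← h1, Measure.conv_comm γ R.pos, Measure.conv_assoc]
    _ = R.pos.conv (γ.conv (S.pos + R.neg)) := by rw [h3]
    _ = (halfLebesgue + γ.conv R.neg).conv (S.pos + R.neg) := by
        rw [← h1, Measure.conv_comm γ R.pos, Measure.conv_assoc]
    _ = (γ.conv R.neg).conv (S.pos + R.neg) + halfLebesgue.conv (S.pos + R.neg) := by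
        rw [Measure.add_conv, add_comm]
    _ = R.neg.conv (γ.conv (S.pos + R.neg)) + halfLebesgue.conv (S.pos + R.neg) := by
        rw [← Measure.conv_assoc, Measure.conv_comm R.neg γ]
    _ = R.neg.conv (γ.conv (R.pos + S.neg)) + halfLebesgue.conv (S.pos + R.neg) := by rw [h3]

end LocSignedMeasure

/-! ### Nonincreasing resolvents preserve nonnegativity -/

namespace LocSignedMeasure

variable {R : LocSignedMeasure} {G : ℝ → ℝ}

/-- Moving the negative parts across turns monotonicity into an inequality between positive
measures, against which nonnegative functions can be integrated. -/
lemma Nonincreasing.restrict_le (hR : R.Nonincreasing) {h₁ h₂ : ℝ} (h0 : 0 ≤ h₁) (h12 : h₁ ≤ h₂)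
    (T : ℝ) :
    (R.pos.map (fun s => s - h₂) + R.neg.map (fun s => s - h₁)).restrict (Icc 0 T)
      ≤ (R.pos.map (fun s => s - h₁) + R.neg.map (fun s => s - h₂)).restrict (Icc 0 T) := by
  refine Measure.le_iff.2 fun A hA => ?_
  have hB : MeasurableSet (A ∩ Icc 0 T) := hA.inter measurableSet_Icc
  have hm : ∀ h : ℝ, Measurable (fun s : ℝ => s - h) := fun h => measurable_id.sub_const h
  have hfin : ∀ (μ : Measure ℝ) [IsHalfLineMeasure μ] (h : ℝ),
      μ ((fun s => s - h) ⁻¹' (A ∩ Icc 0 T)) ≠ ⊤ := fun μ hμ h =>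
    ((measure_mono fun s hs => by
      have := hs.2.2
      simp only [mem_Iic]
      linarith).trans_lt (hμ.Iic_lt_top (T + h))).ne
  have := hR h₁ h₂ h0 h12 T _ hB inter_subset_right
  rw [Measure.restrict_apply hA, Measure.restrict_apply hA, Measure.add_apply, Measure.add_apply,
    Measure.map_apply (hm _) hB, Measure.map_apply (hm _) hB, Measure.map_apply (hm _) hB,
    Measure.map_apply (hm _) hB, ← ENNReal.toReal_le_toReal
      (ENNReal.add_ne_top.2 ⟨hfin _ _, hfin _ _⟩) (ENNReal.add_ne_top.2 ⟨hfin _ _, hfin _ _⟩),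
    ENNReal.toReal_add (hfin _ _) (hfin _ _), ENNReal.toReal_add (hfin _ _) (hfin _ _)]
  simp only [eval] at this
  linarith

/-- For a nonincreasing `R`, convolving a nonnegative function supported in `[0, T]` with `R`
gives a nonincreasing function on `[T, ∞)`. -/
lemma Nonincreasing.integral_le (hR : R.Nonincreasing) {p : ℝ → ℝ} (hpm : Measurable p)
    (hp : ∀ t, 0 ≤ p t) {T : ℝ} (hp0 : ∀ t, t ∉ Icc 0 T → p t = 0)
    (hpos : ∀ t, Integrable (fun s => p (t - s)) R.pos)
    (hneg : ∀ t, Integrable (fun s => p (t - s)) R.neg)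
    {t₁ t₂ : ℝ} (h1 : T ≤ t₁) (h12 : t₁ ≤ t₂) :
    (∫ s, p (t₂ - s) ∂(R.pos)) - ∫ s, p (t₂ - s) ∂(R.neg)
      ≤ (∫ s, p (t₁ - s) ∂(R.pos)) - ∫ s, p (t₁ - s) ∂(R.neg) := by
  -- The reflection of `p` still lives on `[0, T]`, and `p (t - s) = f (s - (t - T))`: the
  -- convolution at time `t` tests `f` against `R` shifted by `t - T`.
  set f : ℝ → ℝ≥0∞ := fun s => ENNReal.ofReal (p (T - s)) with hf
  have hfm : Measurable f := (hpm.comp (measurable_const.sub measurable_id)).ennreal_ofReal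
  have hf0 : f = (Icc 0 T).indicator f := by
    ext s
    by_cases hs : s ∈ Icc 0 T
    · rw [indicator_of_mem hs]
    · rw [indicator_of_notMem hs, hf]
      simp only
      rw [hp0 _ fun h => hs ⟨by linarith [h.2], by linarith [h.1]⟩, ENNReal.ofReal_zero]
  have hle := lintegral_mono' (hR.restrict_le (sub_nonneg.2 h1) (sub_le_sub_right h12 T) T)
    (le_refl f)
  rw [← lintegral_indicator measurableSet_Icc, ← lintegral_indicator measurableSet_Icc, ← hf0,
    lintegral_add_measure, lintegral_add_measure, lintegral_map hfm (by fun_prop),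
    lintegral_map hfm (by fun_prop), lintegral_map hfm (by fun_prop),
    lintegral_map hfm (by fun_prop)] at hle
  have key : ∀ (μ : Measure ℝ) (t : ℝ), Integrable (fun s => p (t - s)) μ →
      ∫⁻ s, f (s - (t - T)) ∂μ = ENNReal.ofReal (∫ s, p (t - s) ∂μ) := by
    intro μ t ht
    rw [ofReal_integral_eq_lintegral_ofReal ht (.of_forall fun s => hp _)]
    refine lintegral_congr fun s => ?_
    simp only [hf]
    congr 2
    ring
  have hnn : ∀ (μ : Measure ℝ) (t : ℝ), 0 ≤ ∫ s, p (t - s) ∂μ := fun μ t =>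
    integral_nonneg fun s => hp _
  rw [key _ _ (hpos _), key _ _ (hpos _), key _ _ (hneg _), key _ _ (hneg _),
    ← ENNReal.ofReal_add (hnn _ _) (hnn _ _), ← ENNReal.ofReal_add (hnn _ _) (hnn _ _),
    ENNReal.ofReal_le_ofReal_iff (add_nonneg (hnn _ _) (hnn _ _))] at hle
  linarith

/-- If the convolution of `q` with the resolvent of a nonnegative kernel is nondecreasing and
nonnegative, then the primitive of `q` is almost everywhere equal to a nondecreasing function. -/
lemma IsResolvent.exists_monotone (hR : R.IsResolvent G) (hG : ∀ t : ℝ, 0 ≤ t → 0 ≤ G t)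
    (hGm : Measurable (zeroExt G)) (hGi : LocallyIntegrableOn G (Ici 0)) {q : ℝ → ℝ}
    (hqm : Measurable q) (hqi : ∀ T, IntegrableOn q (Iic T)) (hq0 : ∀ t < 0, q t = 0)
    (hpos : ∀ t, Integrable (fun s => q (t - s)) R.pos)
    (hneg : ∀ t, Integrable (fun s => q (t - s)) R.neg)
    (hmono : Monotone fun t => (∫ s, q (t - s) ∂(R.pos)) - ∫ s, q (t - s) ∂(R.neg)) :
    ∃ M : ℝ → ℝ≥0∞, Monotone M ∧ ∀ᵐ t, ∫⁻ s in Iic t, ENNReal.ofReal (q s)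
      = (∫⁻ s in Iic t, ENNReal.ofReal (-q s)) + M t := by
  have := isHalfLineMeasure_kernelMeasure hGi
  set φ : ℝ → ℝ := fun t => (∫ s, q (t - s) ∂(R.pos)) - ∫ s, q (t - s) ∂(R.neg) with hφ
  have hφ0 : ∀ t < 0, φ t = 0 := by
    intro t ht
    have h : ∀ (μ : Measure ℝ) [IsHalfLineMeasure μ], ∫ s, q (t - s) ∂μ = 0 := fun μ hμ =>
      integral_eq_zero_of_ae (by
        filter_upwards [IsHalfLineMeasure.ae_nonneg μ] with s hs
        exact hq0 _ (by linarith))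
    simp only [hφ, h, sub_zero]
  have hφnn : ∀ t, 0 ≤ φ t := fun t => by
    rw [← hφ0 (min t (-1)) (by simp)]
    exact hmono (min_le_left _ _)
  have hφm : Measurable φ := hmono.measurable
  set γ := kernelMeasure G with hγ
  set Qp : Measure ℝ := volume.withDensity fun t => ENNReal.ofReal (q t) with hQp
  set Qn : Measure ℝ := volume.withDensity fun t => ENNReal.ofReal (-q t) with hQn
  set Φ : Measure ℝ := volume.withDensity fun t => ENNReal.ofReal (φ t) with hΦ
  have i1 : IsHalfLineMeasure Qp := isHalfLineMeasure_withDensity_ofReal hq0 hqi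
  have i2 : IsHalfLineMeasure Qn := isHalfLineMeasure_withDensity_ofReal (f := fun t => -q t)
    (fun t ht => by simp [hq0 t ht]) fun T => (hqi T).neg
  have i3 : IsHalfLineMeasure Φ := by
    refine isHalfLineMeasure_withDensity_ofReal hφ0 fun T => ?_
    have : IntegrableOn ((Icc 0 T).indicator φ) (Iic T) :=
      ((hmono.monotoneOn _).integrableOn_isCompact isCompact_Icc).integrable_indicator
        measurableSet_Icc |>.integrableOn
    refine this.congr_fun (fun t ht => ?_) measurableSet_Iic
    rcases le_or_gt 0 t with h | h
    · rw [indicator_of_mem (show t ∈ Icc 0 T from ⟨h, ht⟩)]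
    · rw [hφ0 t h, indicator_of_notMem (fun h' => h.not_ge h'.1)]
  have hγR : γ.conv R.pos = halfLebesgue + γ.conv R.neg := hR.kernelMeasure_conv_pos hG hGm
  have hqn : Measurable fun t => -q t := hqm.neg
  -- The identity `q * R = φ`, with `q` and `R` split into positive and negative parts.
  have hRQ : Qp.conv R.pos + Qn.conv R.neg = Qn.conv R.pos + Qp.conv R.neg + Φ := by
    rw [hQp, hQn, hΦ, withDensity_conv hqm.ennreal_ofReal, withDensity_conv hqm.ennreal_ofReal,
      withDensity_conv hqn.ennreal_ofReal, withDensity_conv hqn.ennreal_ofReal,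
      ← withDensity_add_right _ (by
        exact Measurable.lintegral_prod_right (hqn.ennreal_ofReal.comp
          (measurable_fst.sub measurable_snd))),
      ← withDensity_add_right _ (by
        exact Measurable.lintegral_prod_right (hqm.ennreal_ofReal.comp
          (measurable_fst.sub measurable_snd))),
      ← withDensity_add_right _ hφm.ennreal_ofReal]
    congr 1
    ext t
    simp only [Pi.add_apply]
    have f1 : ∀ (μ : Measure ℝ), Integrable (fun s => q (t - s)) μ →
        ∫⁻ s, ENNReal.ofReal (q (t - s)) ∂μ ≠ ⊤ := fun μ hμ =>
      ((lintegral_mono fun s => Real.ofReal_le_enorm _).trans_lt hμ.2).ne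
    have f2 : ∀ (μ : Measure ℝ), Integrable (fun s => q (t - s)) μ →
        ∫⁻ s, ENNReal.ofReal (-q (t - s)) ∂μ ≠ ⊤ := fun μ hμ =>
      ((lintegral_mono fun s => Real.ofReal_le_enorm _).trans_lt hμ.neg.2).ne
    have e1 := integral_eq_lintegral_pos_part_sub_lintegral_neg_part (hpos t)
    have e2 := integral_eq_lintegral_pos_part_sub_lintegral_neg_part (hneg t)
    have hφt : φ t = (∫ s, q (t - s) ∂(R.pos)) - ∫ s, q (t - s) ∂(R.neg) := rfl
    rw [← ENNReal.toReal_eq_toReal_iff'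
      (ENNReal.add_ne_top.2 ⟨f1 _ (hpos t), f2 _ (hneg t)⟩)
      (ENNReal.add_ne_top.2 ⟨ENNReal.add_ne_top.2 ⟨f2 _ (hpos t), f1 _ (hneg t)⟩,
        ENNReal.ofReal_ne_top⟩), ENNReal.toReal_add (f1 _ (hpos t)) (f2 _ (hneg t)),
      ENNReal.toReal_add (ENNReal.add_ne_top.2 ⟨f2 _ (hpos t), f1 _ (hneg t)⟩)
        ENNReal.ofReal_ne_top, ENNReal.toReal_add (f2 _ (hpos t)) (f1 _ (hneg t)),
      ENNReal.toReal_ofReal (hφnn t), hφt]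
    linarith
  -- Convolve `q * R = φ` with `γ` and use `γ * R = λ`; the terms containing `R.neg` occur on both
  -- sides and cancel.
  have hmain : halfLebesgue.conv Qp = halfLebesgue.conv Qn + Φ.conv γ := by
    have h1 : γ.conv (Qp.conv R.pos) = halfLebesgue.conv Qp + γ.conv (Qp.conv R.neg) := by
      rw [Measure.conv_comm Qp R.pos, ← Measure.conv_assoc, hγR, Measure.add_conv,
        Measure.conv_assoc, Measure.conv_comm R.neg]
    have h2 : γ.conv (Qn.conv R.pos) = halfLebesgue.conv Qn + γ.conv (Qn.conv R.neg) := by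
      rw [Measure.conv_comm Qn R.pos, ← Measure.conv_assoc, hγR, Measure.add_conv,
        Measure.conv_assoc, Measure.conv_comm R.neg]
    have h3 := congrArg (fun m => γ.conv m) hRQ
    simp only [Measure.conv_add, h1, h2] at h3
    refine IsHalfLineMeasure.add_left_cancel
      (α := γ.conv (Qp.conv R.neg) + γ.conv (Qn.conv R.neg)) ?_
    rw [Measure.conv_comm Φ γ]
    calc _ = halfLebesgue.conv Qp + γ.conv (Qp.conv R.neg) + γ.conv (Qn.conv R.neg) := by abel
      _ = _ := by rw [h3]; abel
  -- The monotone function is `φ * G`, which inherits monotonicity from `φ` because `γ` is a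
  -- positive measure.
  refine ⟨fun t => ∫⁻ s, ENNReal.ofReal (φ (t - s)) ∂γ, fun a b hab => lintegral_mono fun s =>
    ENNReal.ofReal_le_ofReal (hmono (by linarith)), ?_⟩
  have hIic : ∀ μ : Measure ℝ, Measurable fun t => μ (Iic t) := fun μ =>
    Monotone.measurable fun a b hab => measure_mono (Iic_subset_Iic.2 hab)
  have hM : Measurable fun t => ∫⁻ s, ENNReal.ofReal (φ (t - s)) ∂γ :=
    Measurable.lintegral_prod_right (hφm.ennreal_ofReal.comp (measurable_fst.sub measurable_snd))
  rw [halfLebesgue_conv, halfLebesgue_conv, hΦ, withDensity_conv hφm.ennreal_ofReal,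
    ← withDensity_add_right _ hM, withDensity_eq_iff_of_sigmaFinite (hIic _).aemeasurable
      ((hIic _).add hM).aemeasurable] at hmain
  filter_upwards [hmain] with t ht
  rw [hQp, hQn, Pi.add_apply, withDensity_apply _ measurableSet_Iic,
    withDensity_apply _ measurableSet_Iic] at ht
  exact ht

end LocSignedMeasure

/-- A right-continuous function whose primitive is almost everywhere equal to a nondecreasing
function is nonnegative. -/
lemma nonneg_of_ae_monotone {q : ℝ → ℝ} (hqm : Measurable q) (hqi : ∀ T, IntegrableOn q (Iic T)) {t₀ : ℝ}
    (hq : ContinuousWithinAt q (Ici t₀) t₀) {M : ℝ → ℝ≥0∞} (hM : Monotone M)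
    (h : ∀ᵐ t, ∫⁻ s in Iic t, ENNReal.ofReal (q s)
      = (∫⁻ s in Iic t, ENNReal.ofReal (-q s)) + M t) : 0 ≤ q t₀ := by
  by_contra! hneg
  obtain ⟨u, hu, hlt, hlim⟩ := exists_seq_tendsto_of_ae h t₀
  have hev : ∀ᶠ x in 𝓝[≥] t₀, q x < 0 := hq.eventually_lt_const hneg
  obtain ⟨b, hb, hIco⟩ := (mem_nhdsGE_iff_exists_Ico_subset).1 hev
  have hlim' : Tendsto u atTop (𝓝 t₀) := hlim.mono_right nhdsWithin_le_nhds
  obtain ⟨n, hn⟩ := (hlim'.eventually_lt_const hb).exists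
  -- Now `t₀ < u m < u n < b`, and `q < 0` on `(u m, u n]`: the primitive of `q` strictly decreases
  -- between two points where it equals the nondecreasing `M`.
  obtain ⟨m, hm⟩ := (hlim'.eventually_lt_const (hlt n)).exists
  have hsplit : ∀ f : ℝ → ℝ≥0∞, ∫⁻ s in Iic (u n), f s
      = (∫⁻ s in Iic (u m), f s) + ∫⁻ s in Ioc (u m) (u n), f s := fun f => by
    rw [← Iic_union_Ioc_eq_Iic hm.le, lintegral_union measurableSet_Ioc (by
      rw [Set.disjoint_left]
      exact fun x hx hx' => hx'.1.not_ge hx)]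
  have hqneg : ∀ s ∈ Ioc (u m) (u n), q s < 0 := fun s hs =>
    hIco ⟨(hlt m).le.trans hs.1.le, hs.2.trans_lt hn⟩
  have hA : ∫⁻ s in Ioc (u m) (u n), ENNReal.ofReal (q s) = 0 := by
    rw [setLIntegral_congr_fun measurableSet_Ioc (g := fun _ => 0) fun s hs =>
      ENNReal.ofReal_of_nonpos (hqneg s hs).le]
    simp
  have hB : 0 < ∫⁻ s in Ioc (u m) (u n), ENNReal.ofReal (-q s) := by
    rw [setLIntegral_pos_iff (by fun_prop)]
    have : Function.support (fun s => ENNReal.ofReal (-q s)) ∩ Ioc (u m) (u n)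
        = Ioc (u m) (u n) := inter_eq_right.2 fun s hs => by
      simpa using hqneg s hs
    rw [this, Real.volume_Ioc]
    simpa using hm
  have e1 := hu n
  have e2 := hu m
  rw [hsplit, hsplit (fun s => ENNReal.ofReal (-q s)), hA, add_zero, e2] at e1
  have hfin : (∫⁻ s in Iic (u m), ENNReal.ofReal (-q s)) + M (u m) ≠ ⊤ := by
    rw [← e2]
    exact ((lintegral_mono fun s => Real.ofReal_le_enorm _).trans_lt (hqi (u m)).2).ne
  have : (∫⁻ s in Iic (u m), ENNReal.ofReal (-q s)) + M (u m) <
      (∫⁻ s in Iic (u m), ENNReal.ofReal (-q s)) + M (u m)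
        + ∫⁻ s in Ioc (u m) (u n), ENNReal.ofReal (-q s) :=
    ENNReal.lt_add_right hfin hB.ne'
  refine this.ne (le_antisymm this.le ?_)
  conv_rhs => rw [e1]
  rw [add_right_comm]
  gcongr
  exact hM hm.le

namespace LocSignedMeasure

variable {R : LocSignedMeasure} {G : ℝ → ℝ}

/-- If `f` is nonnegative up to time `T` and its convolution with a nonincreasing resolvent is
constant from time `T` on, then `f` is nonnegative. -/
lemma IsResolvent.nonneg_of_const (hR : R.IsResolvent G) (hmono : R.Nonincreasing)
    (hG : ∀ t : ℝ, 0 ≤ t → 0 ≤ G t)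
    (hGm : Measurable (zeroExt G)) (hGi : LocallyIntegrableOn G (Ici 0)) {f : ℝ → ℝ}
    (hfi : ∀ T, IntegrableOn f (Iic T)) (hf0 : ∀ t < 0, f t = 0)
    (hfc : ∀ t, ContinuousWithinAt f (Ici t) t)
    (hpos : ∀ t, Integrable (fun s => f (t - s)) R.pos)
    (hneg : ∀ t, Integrable (fun s => f (t - s)) R.neg) {T : ℝ} (hfT : ∀ t ≤ T, 0 ≤ f t) {c : ℝ}
    (hc : ∀ t, T ≤ t → (∫ s, f (t - s) ∂(R.pos)) - ∫ s, f (t - s) ∂(R.neg) = c) (t : ℝ) :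
    0 ≤ f t := by
  rcases le_or_gt t T with htT | htT
  · exact hfT t htT
  have hfm : Measurable f := measurable_of_rightContinuous hfc
  set p : ℝ → ℝ := (Iic T).indicator f with hp
  set q : ℝ → ℝ := (Ioi T).indicator f with hq
  have hpq : ∀ u, f u = p u + q u := fun u => by
    rcases le_or_gt u T with h | h
    · simp [hp, hq, h]
    · simp [hp, hq, h]
  have hind : ∀ {A : Set ℝ} (_ : MeasurableSet A) (μ : Measure ℝ) (t : ℝ),
      Integrable (fun s => f (t - s)) μ → Integrable (fun s => A.indicator f (t - s)) μ := by
    intro A hA μ t h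
    exact h.indicator (s := (fun s => t - s) ⁻¹' A) ((measurable_const.sub measurable_id) hA)
  have hp' : ∀ (μ : Measure ℝ) (t : ℝ), Integrable (fun s => f (t - s)) μ →
      Integrable (fun s => p (t - s)) μ := hind measurableSet_Iic
  have hq' : ∀ (μ : Measure ℝ) (t : ℝ), Integrable (fun s => f (t - s)) μ →
      Integrable (fun s => q (t - s)) μ := hind measurableSet_Ioi
  have hsum : ∀ (μ : Measure ℝ) (t : ℝ), Integrable (fun s => f (t - s)) μ →
      ∫ s, f (t - s) ∂μ = ∫ s, p (t - s) ∂μ + ∫ s, q (t - s) ∂μ := fun μ t h => by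
    rw [← integral_add (hp' μ t h) (hq' μ t h)]
    simp only [hpq]
  have hpdec : ∀ t₁ t₂, T ≤ t₁ → t₁ ≤ t₂ → (∫ s, p (t₂ - s) ∂(R.pos)) - ∫ s, p (t₂ - s) ∂(R.neg)
      ≤ (∫ s, p (t₁ - s) ∂(R.pos)) - ∫ s, p (t₁ - s) ∂(R.neg) := fun t₁ t₂ h1 h12 =>
    hmono.integral_le (hfm.indicator measurableSet_Iic)
      (fun t => indicator_nonneg (fun t ht => hfT t ht) t) (T := T) (fun t ht => by
        by_cases h : t ≤ T
        · exact (indicator_of_mem (s := Iic T) h f).trans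
            (hf0 t (lt_of_not_ge fun h' => ht ⟨h', h⟩))
        · exact indicator_of_notMem (s := Iic T) h f)
      (fun t => hp' _ t (hpos t)) (fun t => hp' _ t (hneg t)) h1 h12
  -- After shifting by `T`, the convolution with `R` is nondecreasing on `[0, ∞)` and zero on `(-∞,
  -- 0]`, hence monotone on the whole line.
  set q' : ℝ → ℝ := fun u => q (T + u) with hq'def
  have hq'0 : ∀ u ≤ 0, q' u = 0 := fun u hu =>
    indicator_of_notMem (by simp [hu]) _
  have hshift : ∀ t s, q' (t - s) = q ((T + t) - s) := fun t s => by
    simp only [hq'def]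
    congr 1
    ring
  have hq'zero : ∀ t ≤ 0, ∀ (μ : Measure ℝ) [IsHalfLineMeasure μ], ∫ s, q' (t - s) ∂μ = 0 :=
    fun t ht μ _ => integral_eq_zero_of_ae (by
      filter_upwards [IsHalfLineMeasure.ae_nonneg μ] with s hs
      exact hq'0 _ (by linarith))
  have hdec : ∀ a b, 0 ≤ a → a ≤ b →
      (∫ s, q' (a - s) ∂(R.pos)) - ∫ s, q' (a - s) ∂(R.neg)
        ≤ (∫ s, q' (b - s) ∂(R.pos)) - ∫ s, q' (b - s) ∂(R.neg) := by
    intro a b ha hab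
    simp only [hshift]
    have h1 := hpdec (T + a) (T + b) (by linarith) (by linarith)
    have h2 := hc (T + a) (by linarith)
    have h3 := hc (T + b) (by linarith)
    rw [hsum _ _ (hpos _), hsum _ _ (hneg _)] at h2 h3
    linarith
  have hq'mono : Monotone fun t => (∫ s, q' (t - s) ∂(R.pos)) - ∫ s, q' (t - s) ∂(R.neg) := by
    intro a b hab
    simp only
    rcases le_total 0 a with ha | ha
    · exact hdec a b ha hab
    · rcases le_total 0 b with hb | hb
      · have := hdec 0 b le_rfl hb
        rw [hq'zero 0 le_rfl, hq'zero 0 le_rfl] at this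
        rwa [hq'zero a ha, hq'zero a ha]
      · rw [hq'zero a ha, hq'zero a ha, hq'zero b hb, hq'zero b hb]
  have hq'i : ∀ S, IntegrableOn q' (Iic S) := by
    intro S
    have h1 : IntegrableOn q (Iic (T + S)) := (hfi (T + S)).indicator measurableSet_Ioi
    rw [← integrable_indicator_iff measurableSet_Iic] at h1 ⊢
    refine (h1.comp_add_left T).congr (.of_forall fun u => ?_)
    simp [indicator, hq'def]
  have hq'm : Measurable q' :=
    (hfm.indicator measurableSet_Ioi).comp (measurable_const.add measurable_id)
  obtain ⟨M, hM, hMq⟩ := hR.exists_monotone hG hGm hGi (q := q')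
    hq'm hq'i
    (fun u hu => hq'0 u hu.le)
    (fun t => by simpa only [hshift] using hq' _ _ (hpos (T + t)))
    (fun t => by simpa only [hshift] using hq' _ _ (hneg (T + t))) hq'mono
  have hfq : ∀ u, 0 < u → q' u = f (T + u) := fun u hu =>
    indicator_of_mem (by simpa using hu) f
  have hcont : ContinuousWithinAt q' (Ici (t - T)) (t - T) := by
    have h1 : ContinuousWithinAt f (Ici t) (T + (t - T)) := by
      rw [add_sub_cancel]; exact hfc t
    have h2 : ContinuousWithinAt (fun u => f (T + u)) (Ici (t - T)) (t - T) :=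
      h1.comp (t := Ici t) (f := fun u => T + u) (by fun_prop) fun u hu => by
        simp only [mem_Ici] at *
        linarith
    exact h2.congr (fun u hu => hfq u (by simp only [mem_Ici] at hu; linarith))
      (hfq _ (by linarith))
  have := nonneg_of_ae_monotone hq'm hq'i hcont hM hMq
  rwa [hfq _ (by linarith), add_sub_cancel] at this

end LocSignedMeasure

lemma sum_filter_mul_eq_sum_zeroExt (G : ℝ → ℝ) {K : ℕ} (x t : Fin K → ℝ) (s : ℝ) :
    ∑ k ∈ Finset.univ.filter (fun k => t k ≤ s), x k * G (s - t k)
      = ∑ k, x k * zeroExt G (s - t k) := by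
  rw [Finset.sum_filter]
  refine Finset.sum_congr rfl fun k _ => ?_
  split_ifs with h
  · rw [zeroExt_of_nonneg G (by linarith)]
  · rw [zeroExt_of_neg G (by linarith), mul_zero]

lemma preservesNonneg_iff (G : ℝ → ℝ) : PreservesNonneg G ↔
    ∀ (K : ℕ) (x t : Fin K → ℝ), (∀ k, 0 ≤ t k) → StrictMono t →
      (∀ k, 0 ≤ ∑ k', x k' * zeroExt G (t k - t k')) →
      ∀ s : ℝ, 0 ≤ s → 0 ≤ ∑ k, x k * zeroExt G (s - t k) := by
  refine forall₃_congr fun K x t => forall_congr' fun _ => forall_congr' fun ht => ?_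
  simp_rw [← sum_filter_mul_eq_sum_zeroExt, ht.le_iff_le]

/-- A kernel with a nonincreasing resolvent preserves nonnegativity. -/
theorem LocSignedMeasure.IsResolvent.preservesNonneg {R : LocSignedMeasure} {G : ℝ → ℝ}
    (hR : R.IsResolvent G) (hmono : R.Nonincreasing) (hG : ∀ t : ℝ, 0 ≤ t → 0 ≤ G t)
    (hGc : ∀ t : ℝ, 0 ≤ t → ContinuousWithinAt G (Ici t) t)
    (hGi : LocallyIntegrableOn G (Ici 0)) : PreservesNonneg G := by
  rw [preservesNonneg_iff]
  intro K
  induction K with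
  | zero => intro x t _ _ _ s _; simp
  | succ K ih =>
    intro x t ht0 htm hx s _
    set f : ℝ → ℝ := fun s => ∑ k, x k * zeroExt G (s - t k) with hf
    have hlast : ∀ s < t (Fin.last K),
        f s = ∑ k : Fin K, x k.castSucc * zeroExt G (s - t k.castSucc) := fun s hs => by
      simp only [hf]
      rw [Fin.sum_univ_castSucc, zeroExt_of_neg G (by linarith), mul_zero, add_zero]
    have hf0 : ∀ s < 0, f s = 0 := fun s hs => Finset.sum_eq_zero fun k _ => by
      rw [zeroExt_of_neg G (by linarith [ht0 k]), mul_zero]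
    have hsub : ∀ u s : ℝ, f (u - s) = ∑ k, x k * zeroExt G ((u - t k) - s) := fun u s =>
      Finset.sum_congr rfl fun k _ => by rw [sub_right_comm]
    have hip : ∀ (u : ℝ) (k : Fin (K + 1)),
        Integrable (fun s => x k * zeroExt G ((u - t k) - s)) R.pos := fun u k =>
      (hR.integrable_pos _).const_mul _
    have hin : ∀ (u : ℝ) (k : Fin (K + 1)),
        Integrable (fun s => x k * zeroExt G ((u - t k) - s)) R.neg := fun u k =>
      (hR.integrable_neg _).const_mul _
    refine hR.nonneg_of_const hmono hG (measurable_zeroExt hGc) hGi (f := f)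
      (T := t (Fin.last K)) (c := ∑ k, x k) ?_ hf0 ?_ ?_ ?_ ?_ ?_ s
    · intro T
      refine integrable_finsetSum _ fun k _ => Integrable.const_mul ?_ _
      have h1 := integrableOn_Iic_zeroExt hGi (T - t k)
      change IntegrableOn (fun s => zeroExt G (s - t k)) (Iic T)
      rw [← integrable_indicator_iff measurableSet_Iic] at h1 ⊢
      refine (h1.comp_sub_right (t k)).congr (.of_forall fun u => ?_)
      simp [indicator]
    · intro u
      refine tendsto_finsetSum _ fun k _ => Tendsto.const_mul _ ?_
      have h1 := continuousWithinAt_zeroExt hGc (u - t k)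
      exact h1.comp (t := Ici (u - t k)) (f := fun u => u - t k) (by fun_prop) fun v hv => by
        simp only [mem_Ici] at *
        linarith
    · intro u
      simp only [hsub]
      exact integrable_finsetSum _ fun k _ => hip u k
    · intro u
      simp only [hsub]
      exact integrable_finsetSum _ fun k _ => hin u k
    · intro u hu
      -- Strictly before the last time the last term is absent and the induction hypothesis applies;
      -- at the last time the claim is one of the assumptions.
      rcases lt_or_ge u 0 with hu0 | hu0
      · exact (hf0 u hu0).ge
      rcases hu.lt_or_eq with hu | rfl
      · rw [hlast u hu]
        refine ih (fun k => x k.castSucc) (fun k => t k.castSucc) (fun k => ht0 _)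
          (htm.comp Fin.strictMono_castSucc) (fun k => ?_) u hu0
        rw [← hlast _ (htm (Fin.castSucc_lt_last k))]
        exact hx _
      · exact hx _
    · intro u hu
      -- The resolvent equation turns each translate of `G` into the indicator of `[t k, ∞)`, and
      -- all of these equal `1` from the last time on.
      simp only [hsub]
      rw [integral_finsetSum _ fun k _ => hip u k, integral_finsetSum _ fun k _ => hin u k,
        ← Finset.sum_sub_distrib]
      refine Finset.sum_congr rfl fun k _ => ?_
      rw [integral_const_mul, integral_const_mul, ← mul_sub, hR.integral_sub,
        indicator_of_mem (by simpa using (htm.monotone (Fin.le_last k)).trans hu)]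
      simp

/-! ### Renewal measures and existence of the resolvent -/

/-- The convolution powers of a measure on the line. -/
noncomputable def convPow (ν : Measure ℝ) : ℕ → Measure ℝ
  | 0 => Measure.dirac 0
  | n + 1 => ν.conv (convPow ν n)

/-- The renewal measure, that is the sum of the convolution powers. -/
noncomputable def renewalMeasure (ν : Measure ℝ) : Measure ℝ := Measure.sum (convPow ν)

instance : IsHalfLineMeasure (Measure.dirac 0) :=
  ⟨by simp, fun T => measure_lt_top _ _⟩

instance isHalfLineMeasure_convPow (ν : Measure ℝ) [IsHalfLineMeasure ν] (n : ℕ) :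
    IsHalfLineMeasure (convPow ν n) := by
  induction n with
  | zero => rw [convPow]; infer_instance
  | succ n ih => rw [convPow]; infer_instance

lemma lintegral_exp_convPow (ν : Measure ℝ) [IsHalfLineMeasure ν] (c : ℝ) (n : ℕ) :
    ∫⁻ s, ENNReal.ofReal (Real.exp (-(c * s))) ∂(convPow ν n)
      = (∫⁻ s, ENNReal.ofReal (Real.exp (-(c * s))) ∂ν) ^ n := by
  induction n with
  | zero => simp [convPow]
  | succ n ih =>
    rw [convPow, Measure.lintegral_conv (by fun_prop)]
    have : ∀ x y : ℝ, ENNReal.ofReal (Real.exp (-(c * (x + y)))) =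
        ENNReal.ofReal (Real.exp (-(c * x))) * ENNReal.ofReal (Real.exp (-(c * y))) := fun x y => by
      rw [← ENNReal.ofReal_mul (Real.exp_pos _).le, ← Real.exp_add]
      ring_nf
    simp_rw [this]
    simp_rw [lintegral_const_mul _ (show Measurable fun y : ℝ =>
      ENNReal.ofReal (Real.exp (-(c * y))) by fun_prop), ih]
    rw [lintegral_mul_const _ (by fun_prop), pow_succ']

/-- Since `ν` charges only `(0, ∞)`, its Laplace transform tends to `0` at infinity by dominated
convergence. -/
lemma exists_lintegral_exp_lt_one (ν : Measure ℝ) [IsFiniteMeasure ν] (h0 : ν (Iic 0) = 0) :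
    ∃ c : ℝ, 0 ≤ c ∧ ∫⁻ s, ENNReal.ofReal (Real.exp (-(c * s))) ∂ν < 1 := by
  have hae : ∀ᵐ s ∂ν, 0 < s := by
    rw [ae_iff]
    convert h0 using 2
    ext; simp
  have hlim : Tendsto (fun n : ℕ => ∫⁻ s, ENNReal.ofReal (Real.exp (-((n : ℝ) * s))) ∂ν) atTop
      (𝓝 (∫⁻ _, 0 ∂ν)) := by
    refine tendsto_lintegral_of_dominated_convergence (fun _ => 1) (fun n => by fun_prop)
      (fun n => ?_) (by simp) ?_
    · filter_upwards [hae] with s hs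
      rw [← ENNReal.ofReal_one]
      refine ENNReal.ofReal_le_ofReal (Real.exp_le_one_iff.2 ?_)
      have : 0 ≤ (n : ℝ) * s := by positivity
      linarith
    · filter_upwards [hae] with s hs
      rw [← ENNReal.ofReal_zero]
      refine ENNReal.tendsto_ofReal (Real.tendsto_exp_neg_atTop_nhds_zero.comp ?_)
      exact tendsto_natCast_atTop_atTop.atTop_mul_const hs
  rw [lintegral_zero] at hlim
  obtain ⟨n, hn⟩ := (hlim.eventually_lt_const zero_lt_one).exists
  exact ⟨n, n.cast_nonneg, hn⟩

/-- On `(-∞, T]` one has `1 ≤ exp (c * T) * exp (-(c * s))`, and the Laplace transform is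
multiplicative under convolution. The masses of the convolution powers are thus dominated by a
convergent geometric series. -/
lemma isHalfLineMeasure_renewalMeasure (ν : Measure ℝ) [IsFiniteMeasure ν]
    [IsHalfLineMeasure ν] (h0 : ν (Iic 0) = 0) : IsHalfLineMeasure (renewalMeasure ν) := by
  obtain ⟨c, hc, h1⟩ := exists_lintegral_exp_lt_one ν h0
  constructor
  · rw [renewalMeasure, Measure.sum_apply _ measurableSet_Iio]
    exact ENNReal.tsum_eq_zero.2 fun n => (isHalfLineMeasure_convPow ν n).Iio_eq_zero
  · intro T
    rw [renewalMeasure, Measure.sum_apply _ measurableSet_Iic]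
    have hle : ∀ n, convPow ν n (Iic T) ≤ ENNReal.ofReal (Real.exp (c * T)) *
        (∫⁻ s, ENNReal.ofReal (Real.exp (-(c * s))) ∂ν) ^ n := by
      intro n
      rw [← lintegral_exp_convPow, ← lintegral_const_mul _ (by fun_prop),
        ← lintegral_indicator_one measurableSet_Iic]
      refine lintegral_mono (indicator_le fun s hs => ?_)
      rw [← ENNReal.ofReal_mul (Real.exp_pos _).le, ← Real.exp_add, Pi.one_apply,
        ← ENNReal.ofReal_one]
      refine ENNReal.ofReal_le_ofReal (Real.one_le_exp ?_)
      have : 0 ≤ c * (T - s) := mul_nonneg hc (sub_nonneg.2 hs)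
      linarith
    refine (ENNReal.tsum_le_tsum hle).trans_lt ?_
    rw [ENNReal.tsum_mul_left, ENNReal.tsum_geometric]
    exact ENNReal.mul_lt_top ENNReal.ofReal_lt_top
      (ENNReal.inv_lt_top.2 (tsub_pos_of_lt h1))

/-- The renewal equation. -/
lemma renewalMeasure_Iic (ν : Measure ℝ) [IsFiniteMeasure ν] [IsHalfLineMeasure ν]
    [IsHalfLineMeasure (renewalMeasure ν)] {t : ℝ} (ht : 0 ≤ t) :
    renewalMeasure ν (Iic t) = 1 + ∫⁻ s, ν (Iic (t - s)) ∂(renewalMeasure ν) := by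
  -- Commuting the convolution puts the series inside an integral against `ν`, so that it can be
  -- exchanged termwise: this is `U = δ₀ + ν * U`.
  rw [← IsHalfLineMeasure.conv_Iic, Measure.conv_comm, IsHalfLineMeasure.conv_Iic]
  simp only [renewalMeasure, Measure.sum_apply _ measurableSet_Iic]
  have hm : ∀ n, Measurable fun s => convPow ν n (Iic (t - s)) := fun n =>
    Measurable.comp (g := fun u => convPow ν n (Iic u))
      (Monotone.measurable fun a b hab => measure_mono (Iic_subset_Iic.2 hab))
      (measurable_const.sub measurable_id)
  rw [lintegral_tsum fun n => (hm n).aemeasurable, tsum_eq_zero_add' ENNReal.summable]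
  congr 1
  · simp [convPow, ht]
  · exact tsum_congr fun n => IsHalfLineMeasure.conv_Iic _ _ _

lemma exists_measure_of_antitone {G : ℝ → ℝ} (hG : ∀ t : ℝ, 0 ≤ t → 0 ≤ G t) (hG0 : 0 < G 0)
    (hGc : ∀ t : ℝ, 0 ≤ t → ContinuousWithinAt G (Ici t) t) (hGa : AntitoneOn G (Ici 0)) :
    ∃ ν : Measure ℝ, IsFiniteMeasure ν ∧
      ∀ t, ν (Iic t) = ENNReal.ofReal (1 - G (max t 0) / G 0) := by
  -- Freezing the argument at `0` for negative times makes the function vanish on `(-∞, 0]`, so the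
  -- measure has no atom at `0`.
  let S : StieltjesFunction ℝ :=
    { toFun := fun t => 1 - G (max t 0) / G 0
      mono' := fun a b hab => by
        have := hGa (le_max_right a 0) (le_max_right b 0) (max_le_max_right 0 hab)
        simp only
        gcongr
      right_continuous' := fun t => by
        refine continuousWithinAt_const.sub (ContinuousWithinAt.div_const ?_ _)
        exact (hGc (max t 0) (le_max_right t 0)).comp (t := Ici (max t 0))
          (f := fun u => max u 0) (by fun_prop) fun v hv =>
            mem_Ici.2 (max_le_max_right 0 hv) }
  have hS : ∀ t, S t = 1 - G (max t 0) / G 0 := fun _ => rfl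
  refine ⟨S.measure, S.isFiniteMeasure_of_forall_abs_le (C := 1) fun t => ?_, fun t => ?_⟩
  · have h1 := hG (max t 0) (le_max_right t 0)
    have h2 : G (max t 0) ≤ G 0 := hGa self_mem_Ici (le_max_right t 0) (le_max_right t 0)
    have h3 : G (max t 0) / G 0 ≤ 1 := (div_le_one hG0).2 h2
    have h4 : 0 ≤ G (max t 0) / G 0 := div_nonneg h1 hG0.le
    rw [hS, abs_le]
    constructor <;> linarith
  · have hlim : Tendsto S atBot (𝓝 0) := by
      refine tendsto_const_nhds.congr' ?_
      filter_upwards [eventually_le_atBot (0 : ℝ)] with t ht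
      rw [hS, max_eq_right ht, div_self hG0.ne', sub_self]
    rw [S.measure_Iic hlim, sub_zero, hS]

/-- A nonincreasing kernel has a resolvent of the first kind, and it is a nonnegative measure. -/
lemma exists_isResolvent_of_antitone {G : ℝ → ℝ} (hG : ∀ t : ℝ, 0 ≤ t → 0 ≤ G t) (hG0 : 0 < G 0)
    (hGc : ∀ t : ℝ, 0 ≤ t → ContinuousWithinAt G (Ici t) t) (hGa : AntitoneOn G (Ici 0)) :
    ∃ R : LocSignedMeasure, R.IsResolvent G ∧ R.neg = 0 := by
  obtain ⟨ν, hνf, hν⟩ := exists_measure_of_antitone hG hG0 hGc hGa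
  have hν0 : ∀ t ≤ 0, ν (Iic t) = 0 := fun t ht => by
    rw [hν, max_eq_right ht, div_self hG0.ne', sub_self, ENNReal.ofReal_zero]
  have : IsHalfLineMeasure ν :=
    ⟨measure_mono_null Iio_subset_Iic_self (hν0 0 le_rfl), fun T => measure_lt_top _ _⟩
  have hU := isHalfLineMeasure_renewalMeasure ν (hν0 0 le_rfl)
  have hGm := measurable_zeroExt hGc
  have hlint : ∀ t, 0 ≤ t →
      ∫⁻ s, ENNReal.ofReal (zeroExt G (t - s)) ∂(renewalMeasure ν) = ENNReal.ofReal (G 0) := by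
    intro t ht
    -- This is `G = G 0 * (1 - ν (Iic ·))` without subtraction. Integrated against the renewal
    -- measure and compared with the renewal equation, it leaves only the constant `G 0`.
    have hpt : ∀ s, ENNReal.ofReal (zeroExt G (t - s)) + ENNReal.ofReal (G 0) * ν (Iic (t - s))
        = ENNReal.ofReal (G 0) * (Iic t).indicator 1 s := by
      intro s
      by_cases hs : s ≤ t
      · have h2 : G (t - s) ≤ G 0 := hGa self_mem_Ici (sub_nonneg.2 hs) (sub_nonneg.2 hs)
        rw [zeroExt_of_nonneg G (sub_nonneg.2 hs), hν, max_eq_left (sub_nonneg.2 hs),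
          indicator_of_mem (by exact hs), Pi.one_apply, mul_one, ← ENNReal.ofReal_mul hG0.le,
          ← ENNReal.ofReal_add (hG _ (sub_nonneg.2 hs))
            (mul_nonneg hG0.le (sub_nonneg.2 ((div_le_one hG0).2 h2)))]
        congr 1
        field_simp
        ring
      · rw [zeroExt_of_neg G (by linarith), hν0 _ (by linarith),
          indicator_of_notMem (by exact hs)]
        simp
    have hmeas : Measurable fun s => ν (Iic (t - s)) :=
      Measurable.comp (g := fun u => ν (Iic u))
        (Monotone.measurable fun a b hab => measure_mono (Iic_subset_Iic.2 hab))
        (measurable_const.sub measurable_id)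
    have hint := lintegral_congr (μ := renewalMeasure ν) hpt
    rw [lintegral_add_right _ (hmeas.const_mul _), lintegral_const_mul _ hmeas,
      lintegral_const_mul _ (measurable_one.indicator measurableSet_Iic),
      lintegral_indicator_one measurableSet_Iic, renewalMeasure_Iic ν ht, mul_add, mul_one] at hint
    refine (ENNReal.add_left_inj (ENNReal.mul_ne_top ENNReal.ofReal_ne_top ?_)).1 hint
    rw [← IsHalfLineMeasure.conv_Iic]
    exact (IsHalfLineMeasure.Iic_lt_top t).ne
  obtain ⟨R, hRpos, hRneg⟩ : ∃ R : LocSignedMeasure,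
      R.pos = ENNReal.ofReal (1 / G 0) • renewalMeasure ν ∧ R.neg = 0 := ⟨
    { pos := ENNReal.ofReal (1 / G 0) • renewalMeasure ν
      neg := 0
      pos_Iio := by simp [hU.Iio_eq_zero]
      neg_Iio := by simp
      pos_finite := fun T => by
        rw [Measure.smul_apply, smul_eq_mul]
        exact ENNReal.mul_lt_top ENNReal.ofReal_lt_top
          ((measure_mono Icc_subset_Iic_self).trans_lt (hU.Iic_lt_top T))
      neg_finite := by simp
      singular := Measure.MutuallySingular.zero_right }, rfl, rfl⟩
  have hone : ∀ t, 0 ≤ t → ∫⁻ s, ENNReal.ofReal (zeroExt G (t - s)) ∂(R.pos) = 1 := by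
    intro t ht
    rw [hRpos, lintegral_smul_measure, hlint t ht, smul_eq_mul, ← ENNReal.ofReal_mul (by positivity),
      one_div_mul_cancel hG0.ne', ENNReal.ofReal_one]
  have hnn : ∀ t, ∀ s, 0 ≤ zeroExt G (t - s) := fun t s => zeroExt_nonneg hG _
  have hmt : ∀ t, Measurable fun s => zeroExt G (t - s) := fun t =>
    hGm.comp (measurable_const.sub measurable_id)
  refine ⟨R, fun t ht => ⟨?_, ?_⟩, hRneg⟩
  · have : R.totalVariation = R.pos := by
      rw [LocSignedMeasure.totalVariation, hRneg, add_zero]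
    rw [this, ← integrable_zeroExt_iff]
    refine ⟨(hmt t).aestronglyMeasurable, ?_⟩
    rw [hasFiniteIntegral_iff_ofReal (.of_forall (hnn t)), hone t ht]
    exact ENNReal.one_lt_top
  · have : R.setIntegral (Icc 0 t) (fun s => G (t - s)) = ∫ s in Icc 0 t, G (t - s) ∂(R.pos) := by
      simp [LocSignedMeasure.setIntegral, hRneg]
    rw [this, ← integral_zeroExt, integral_eq_lintegral_of_nonneg_ae (.of_forall (hnn t))
      (hmt t).aestronglyMeasurable, hone t ht, ENNReal.toReal_one]

/-! ### Discrete resolvents and concavity of the distribution function -/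

lemma PowerSeries.coeff_mul_mk (A : PowerSeries ℝ) (g : ℕ → ℝ) (k : ℕ) :
    PowerSeries.coeff k (A * PowerSeries.mk g)
      = ∑ j ∈ Finset.range (k + 1), PowerSeries.coeff j A * g (k - j) := by
  rw [PowerSeries.coeff_mul]
  simp only [PowerSeries.coeff_mk]
  exact Finset.Nat.sum_antidiagonal_eq_sum_range_succ (fun i j => PowerSeries.coeff i A * g j) k

/-- A sequence with nonzero first term has a convolution inverse `a` and a discrete resolvent `r`,
the sequence of partial sums of `a`. -/
lemma exists_discrete_resolvent {g : ℕ → ℝ} (hg : g 0 ≠ 0) : ∃ a r : ℕ → ℝ,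
    (∀ k, ∑ j ∈ Finset.range (k + 1), a j * g (k - j) = if k = 0 then 1 else 0) ∧
    (∀ k, r (k + 1) = r k + a (k + 1)) ∧
    ∀ k, ∑ j ∈ Finset.range (k + 1), r j * g (k - j) = 1 := by
  -- Convolution inverses are inverses of power series; multiplying by `∑ Xⁿ` takes partial sums of
  -- the coefficients.
  set A : PowerSeries ℝ := (PowerSeries.mk g)⁻¹ with hA
  have h1 : A * PowerSeries.mk g = 1 := PowerSeries.inv_mul_cancel _ (by simpa using hg)
  have h2 : A * PowerSeries.mk (fun _ => 1) * PowerSeries.mk g = PowerSeries.mk (fun _ => 1) := by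
    rw [mul_right_comm, h1, one_mul]
  refine ⟨fun k => PowerSeries.coeff k A,
    fun k => PowerSeries.coeff k (A * PowerSeries.mk (fun _ => 1)), fun k => ?_, fun k => ?_,
    fun k => ?_⟩
  · rw [← PowerSeries.coeff_mul_mk, h1, PowerSeries.coeff_one]
  · simp only [PowerSeries.coeff_mul_mk]
    rw [Finset.sum_range_succ, mul_one]
  · rw [← PowerSeries.coeff_mul_mk, h2, PowerSeries.coeff_mk]

lemma sum_zeroExt_grid (G : ℝ → ℝ) {ε : ℝ} (hε : 0 < ε) (c : ℕ → ℝ) {m N : ℕ} (hm : m < N) :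
    ∑ j ∈ Finset.range N, c j * zeroExt G (m * ε - j * ε)
      = ∑ j ∈ Finset.range (m + 1), c j * G ((m - j : ℕ) * ε) := by
  rw [← Finset.sum_subset (Finset.range_subset_range.2 hm) fun j _ hj => ?_]
  · refine Finset.sum_congr rfl fun j hj => ?_
    have hj' : j ≤ m := Nat.lt_succ_iff.1 (Finset.mem_range.1 hj)
    rw [← sub_mul, ← Nat.cast_sub hj', zeroExt_of_nonneg G (by positivity)]
  · have hj' : (m : ℝ) + 1 ≤ j := by exact_mod_cast not_lt.1 fun h => hj (Finset.mem_range.2 h)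
    rw [zeroExt_of_neg G (by nlinarith), mul_zero]

/-- If a nonincreasing kernel preserves nonnegativity, then its discrete resolvents are nonnegative
and nonincreasing. -/
lemma PreservesNonneg.exists_antitone_discrete_resolvent {G : ℝ → ℝ} (hPN : PreservesNonneg G)
    (hG0 : 0 < G 0) (hGa : AntitoneOn G (Ici 0)) {ε : ℝ} (hε : 0 < ε) :
    ∃ r : ℕ → ℝ, Antitone r ∧ (∀ k, 0 ≤ r k) ∧
      ∀ k : ℕ, ∑ j ∈ Finset.range (k + 1), r j * G ((k - j : ℕ) * ε) = 1 := by
  rw [preservesNonneg_iff] at hPN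
  obtain ⟨a, r, ha, har, hr⟩ := exists_discrete_resolvent (g := fun n : ℕ => G (n * ε))
    (by simpa using hG0.ne')
  -- With weights `a 0, …, a k` the sums at the grid times are `1, 0, …, 0`. At the next grid time
  -- the sum is `-a (k + 1) * G 0`, and it must be nonnegative.
  have ha' : ∀ k, a (k + 1) ≤ 0 := by
    intro k
    have h := hPN (k + 1) (fun j => a j) (fun j => (j : ℕ) * ε) (fun j => by positivity)
      (fun i j hij => by
        have : ((i : ℕ) : ℝ) < (j : ℕ) := by exact_mod_cast hij
        exact mul_lt_mul_of_pos_right this hε) (fun m => by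
        rw [Fin.sum_univ_eq_sum_range
          (fun j => a j * zeroExt G ((m : ℕ) * ε - j * ε)) (k + 1), sum_zeroExt_grid G hε a m.2, ha]
        split_ifs <;> simp) (((k + 1 : ℕ) : ℝ) * ε) (by positivity)
    rw [Fin.sum_univ_eq_sum_range
      (fun j => a j * zeroExt G (((k + 1 : ℕ) : ℝ) * ε - j * ε)) (k + 1)] at h
    have h2 := sum_zeroExt_grid G hε a (Nat.lt_succ_self (k + 1))
    rw [ha, if_neg (Nat.succ_ne_zero k), Finset.sum_range_succ, sub_self,
      zeroExt_of_nonneg G le_rfl] at h2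
    nlinarith
  have hr0 : ∀ k, 0 ≤ r k := by
    intro k
    induction k using Nat.strong_induction_on with
    | _ k ih =>
      rcases k with _ | k
      · have := hr 0
        simp only [zero_add, Finset.sum_range_one, Nat.sub_zero, Nat.cast_zero, zero_mul] at this
        by_contra! h
        nlinarith
      · have h1 := hr (k + 1)
        have h2 := hr k
        rw [Finset.sum_range_succ] at h1
        -- Both resolvent sums equal `1`. As `G` is nonincreasing, the old terms do not grow from
        -- time `k` to `k + 1`, so the new term `r (k + 1) * G 0` is nonnegative.
        have h3 : ∑ j ∈ Finset.range (k + 1), r j * G ((k + 1 - j : ℕ) * ε)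
            ≤ ∑ j ∈ Finset.range (k + 1), r j * G ((k - j : ℕ) * ε) :=
          Finset.sum_le_sum fun j hj => mul_le_mul_of_nonneg_left
            (hGa (mem_Ici.2 (by positivity)) (mem_Ici.2 (by positivity)) (by
              gcongr
              omega)) (ih j (Finset.mem_range.1 hj))
        simp only [Nat.sub_self, Nat.cast_zero, zero_mul] at h1
        by_contra! h
        nlinarith
  exact ⟨r, antitone_nat_of_succ_le fun k => by linarith [har k, ha' k], hr0, hr⟩

/-- The discrete resolvents of a nonincreasing kernel approximate its resolvent. -/
lemma sum_discrete_resolvent_mem_Icc {G : ℝ → ℝ} (hG0 : 0 < G 0)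
    (hGa : AntitoneOn G (Ici 0)) {ε : ℝ} (hε : 0 < ε) {r : ℕ → ℝ} (hra : Antitone r)
    (hr0 : ∀ k, 0 ≤ r k)
    (hr : ∀ k : ℕ, ∑ j ∈ Finset.range (k + 1), r j * G ((k - j : ℕ) * ε) = 1)
    (μ : Measure ℝ) [hμ : IsHalfLineMeasure μ]
    (hint : ∀ t, Integrable (fun s => zeroExt G (t - s)) μ)
    (hone : ∀ t, 0 ≤ t → ∫ s, zeroExt G (t - s) ∂μ = 1) {t : ℝ} (ht : 0 ≤ t) :
    ∑ j ∈ Finset.range (⌊t / ε⌋₊ + 1), r j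
      ∈ Icc (G ε / G 0 * μ.real (Iic t)) (μ.real (Iic t)) := by
  set k := ⌊t / ε⌋₊ with hk
  -- The sum `C` is nearly `1` on `[0, t]`, and integrating `C (t - s)` against `μ` gives exactly `∑
  -- r j`.
  set C : ℝ → ℝ := fun u => ∑ j ∈ Finset.range (k + 1), r j * zeroExt G (u - j * ε) with hC
  have hCneg : ∀ u < 0, C u = 0 := fun u hu => Finset.sum_eq_zero fun j _ => by
    have : (0 : ℝ) ≤ j * ε := by positivity
    rw [zeroExt_of_neg G (by linarith), mul_zero]
  have hCb : ∀ u, 0 ≤ u → u ≤ t → G ε / G 0 ≤ C u ∧ C u ≤ 1 := by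
    intro u hu hut
    set m := ⌊u / ε⌋₊ with hm
    have hm1 : m * ε ≤ u := (le_div_iff₀ hε).1 (Nat.floor_le (div_nonneg hu hε.le))
    have hm2 : u < (m + 1) * ε := (div_lt_iff₀ hε).1 (Nat.lt_floor_add_one _)
    have hmk : m ≤ k := Nat.floor_le_floor (div_le_div_of_nonneg_right hut hε.le)
    have hCm : C u = ∑ j ∈ Finset.range (m + 1), r j * G (u - j * ε) := by
      simp only [hC]
      rw [← Finset.sum_subset (Finset.range_subset_range.2 (Nat.succ_le_succ hmk)) fun j _ hj => ?_]
      · refine Finset.sum_congr rfl fun j hj => ?_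
        have hj' : (j : ℝ) ≤ m := by exact_mod_cast Nat.lt_succ_iff.1 (Finset.mem_range.1 hj)
        rw [zeroExt_of_nonneg G (by nlinarith)]
      · have hj' : (m : ℝ) + 1 ≤ j := by exact_mod_cast not_lt.1 fun h => hj (Finset.mem_range.2 h)
        rw [zeroExt_of_neg G (by nlinarith), mul_zero]
    constructor
    · have h1 := hr (m + 1)
      rw [Finset.sum_range_succ] at h1
      have h2 := hr 0
      have h3 := hr 1
      simp only [zero_add, Nat.sub_zero, Nat.cast_zero, zero_mul,
        Finset.sum_range_succ, Nat.sub_self, Nat.cast_one, one_mul, Finset.sum_range_zero]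
        at h1 h2 h3
      have h4 : ∑ j ∈ Finset.range (m + 1), r j * G ((m + 1 - j : ℕ) * ε) ≤ C u := by
        rw [hCm]
        refine Finset.sum_le_sum fun j hj => mul_le_mul_of_nonneg_left ?_ (hr0 j)
        have hj' : j ≤ m := Nat.lt_succ_iff.1 (Finset.mem_range.1 hj)
        have hj'' : (j : ℝ) ≤ m := by exact_mod_cast hj'
        refine hGa (mem_Ici.2 (by nlinarith)) (mem_Ici.2 (by positivity)) ?_
        rw [Nat.cast_sub (by omega)]
        push_cast
        linarith
      have h5 : r (m + 1) * G 0 ≤ r 1 * G 0 :=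
        mul_le_mul_of_nonneg_right (hra (by omega)) hG0.le
      have h6 : r 0 = 1 / G 0 := by field_simp; linarith
      have h7 : G ε / G 0 = r 0 * G ε := by rw [h6]; ring
      rw [Finset.sum_range_succ] at h4
      linarith
    · rw [hCm, ← hr m]
      refine Finset.sum_le_sum fun j hj => mul_le_mul_of_nonneg_left ?_ (hr0 j)
      have hj' : j ≤ m := Nat.lt_succ_iff.1 (Finset.mem_range.1 hj)
      have hj'' : (j : ℝ) ≤ m := by exact_mod_cast hj'
      refine hGa (mem_Ici.2 (by positivity)) (mem_Ici.2 (by nlinarith)) ?_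
      rw [Nat.cast_sub hj']
      linarith
  have hCt : ∀ s, C (t - s) = ∑ j ∈ Finset.range (k + 1), r j * zeroExt G ((t - j * ε) - s) :=
    fun s => Finset.sum_congr rfl fun j _ => by rw [sub_right_comm]
  have hCi : Integrable (fun s => C (t - s)) μ := by
    simp only [hCt]
    exact integrable_finsetSum _ fun j _ => (hint _).const_mul _
  have hsum : ∑ j ∈ Finset.range (k + 1), r j = ∫ s, C (t - s) ∂μ := by
    simp only [hCt]
    rw [integral_finsetSum _ fun j _ => (hint _).const_mul _]
    refine Finset.sum_congr rfl fun j hj => ?_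
    have hj' : (j : ℝ) ≤ k := by exact_mod_cast Nat.lt_succ_iff.1 (Finset.mem_range.1 hj)
    have hk1 : k * ε ≤ t := (le_div_iff₀ hε).1 (Nat.floor_le (div_nonneg ht hε.le))
    rw [integral_const_mul, hone _ (by nlinarith), mul_one]
  have hind : ∀ c : ℝ, Integrable ((Iic t).indicator fun _ => c) μ := fun c =>
    (integrable_indicator_iff measurableSet_Iic).2
      (integrableOn_const (hμ.Iic_lt_top t).ne)
  have hindi : ∀ c : ℝ, ∫ s, (Iic t).indicator (fun _ => c) s ∂μ = c * μ.real (Iic t) := fun c => by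
    rw [integral_indicator measurableSet_Iic, setIntegral_const, smul_eq_mul, mul_comm]
  rw [hsum]
  constructor
  · rw [← hindi]
    refine integral_mono_ae (hind _) hCi ?_
    filter_upwards [IsHalfLineMeasure.ae_nonneg μ] with s hs
    by_cases h : s ≤ t
    · simp only [indicator_of_mem (show s ∈ Iic t from h)]
      exact (hCb _ (by linarith) (by linarith)).1
    · simp only [indicator_of_notMem (show s ∉ Iic t from h)]
      exact (hCneg _ (by linarith)).ge
  · rw [← one_mul (μ.real (Iic t)), ← hindi]
    refine integral_mono_ae hCi (hind _) ?_
    filter_upwards [IsHalfLineMeasure.ae_nonneg μ] with s hs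
    by_cases h : s ≤ t
    · simp only [indicator_of_mem (show s ∈ Iic t from h)]
      exact (hCb _ (by linarith) (by linarith)).2
    · simp only [indicator_of_notMem (show s ∉ Iic t from h)]
      exact (hCneg _ (by linarith)).le

/-- Partial sums of a nonincreasing sequence are concave: the mean of `r` over `(b, c]` is at most
`r b`, itself at most the mean over `(a, b]`. The products avoid division when `a = b` or `b = c`.
-/
lemma Antitone.sum_range_sub_mul_le {r : ℕ → ℝ} (hr : Antitone r) {a b c : ℕ} (hab : a ≤ b)
    (hbc : b ≤ c) :
    ((∑ j ∈ Finset.range (c + 1), r j) - ∑ j ∈ Finset.range (b + 1), r j) * ((b : ℝ) - a)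
      ≤ ((∑ j ∈ Finset.range (b + 1), r j) - ∑ j ∈ Finset.range (a + 1), r j) * ((c : ℝ) - b) := by
  have h1 : (∑ j ∈ Finset.range (c + 1), r j) - ∑ j ∈ Finset.range (b + 1), r j
      ≤ ((c : ℝ) - b) * r b := by
    rw [← Finset.sum_Ico_eq_sub _ (Nat.succ_le_succ hbc)]
    refine (Finset.sum_le_card_nsmul _ _ (r b) fun j hj => hr ?_).trans_eq ?_
    · have := (Finset.mem_Ico.1 hj).1
      omega
    · rw [Nat.card_Ico, nsmul_eq_mul, Nat.cast_sub (by omega)]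
      push_cast
      ring
  have h2 : ((b : ℝ) - a) * r b
      ≤ (∑ j ∈ Finset.range (b + 1), r j) - ∑ j ∈ Finset.range (a + 1), r j := by
    rw [← Finset.sum_Ico_eq_sub _ (Nat.succ_le_succ hab)]
    refine Eq.trans_le ?_ (Finset.card_nsmul_le_sum _ _ (r b) fun j hj => hr ?_)
    · rw [Nat.card_Ico, nsmul_eq_mul, Nat.cast_sub (by omega)]
      push_cast
      ring
    · have := (Finset.mem_Ico.1 hj).2
      omega
  have h3 : (0 : ℝ) ≤ (b : ℝ) - a := sub_nonneg.2 (by exact_mod_cast hab)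
  have h4 : (0 : ℝ) ≤ (c : ℝ) - b := sub_nonneg.2 (by exact_mod_cast hbc)
  calc _ ≤ ((c : ℝ) - b) * r b * ((b : ℝ) - a) := mul_le_mul_of_nonneg_right h1 h3
    _ = ((b : ℝ) - a) * r b * ((c : ℝ) - b) := by ring
    _ ≤ _ := mul_le_mul_of_nonneg_right h2 h4

/-- If a nonincreasing kernel preserves nonnegativity and its resolvent is a nonnegative measure,
then the resolvent has a concave distribution function. -/
lemma PreservesNonneg.concaveOn_Iic {G : ℝ → ℝ} (hPN : PreservesNonneg G)
    (hG0 : 0 < G 0) (hGc : ContinuousWithinAt G (Ici 0) 0) (hGa : AntitoneOn G (Ici 0))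
    (μ : Measure ℝ) [IsHalfLineMeasure μ]
    (hint : ∀ t, Integrable (fun s => zeroExt G (t - s)) μ)
    (hone : ∀ t, 0 ≤ t → ∫ s, zeroExt G (t - s) ∂μ = 1) :
    ConcaveOn ℝ (Ici 0) fun t => μ.real (Iic t) := by
  have hM : ∀ n : ℕ, (0 : ℝ) < (n : ℝ) + 1 := fun n => by positivity
  choose r hra hr0 hr using fun n : ℕ =>
    hPN.exists_antitone_discrete_resolvent hG0 hGa (one_div_pos.2 (hM n))
  have hlim1 : Tendsto (fun n : ℕ => G (1 / ((n : ℝ) + 1)) / G 0) atTop (𝓝 1) := by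
    have h : Tendsto (fun n : ℕ => 1 / ((n : ℝ) + 1)) atTop (𝓝[≥] 0) := tendsto_nhdsWithin_iff.2
      ⟨tendsto_one_div_add_atTop_nhds_zero_nat, .of_forall fun n => (one_div_pos.2 (hM n)).le⟩
    simpa [hG0.ne'] using (hGc.tendsto.comp h).div_const (G 0)
  have hmem : ∀ t, 0 ≤ t → ∀ n : ℕ, ∑ j ∈ Finset.range (⌊t * ((n : ℝ) + 1)⌋₊ + 1), r n j
      ∈ Icc (G (1 / ((n : ℝ) + 1)) / G 0 * μ.real (Iic t)) (μ.real (Iic t)) := fun t ht n => by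
    have := sum_discrete_resolvent_mem_Icc hG0 hGa (one_div_pos.2 (hM n)) (hra n) (hr0 n) (hr n) μ
      hint hone ht
    rwa [div_div_eq_mul_div, div_one] at this
  have hlim2 : ∀ t, 0 ≤ t → Tendsto (fun n : ℕ =>
      ∑ j ∈ Finset.range (⌊t * ((n : ℝ) + 1)⌋₊ + 1), r n j) atTop (𝓝 (μ.real (Iic t))) := by
    intro t ht
    refine tendsto_of_tendsto_of_tendsto_of_le_of_le ?_ tendsto_const_nhds
      (fun n => (hmem t ht n).1) (fun n => (hmem t ht n).2)
    simpa using hlim1.mul_const (μ.real (Iic t))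
  have hlim3 : ∀ t : ℝ, 0 ≤ t → Tendsto (fun n : ℕ =>
      (⌊t * ((n : ℝ) + 1)⌋₊ : ℝ) / ((n : ℝ) + 1)) atTop (𝓝 t) := fun t ht =>
    (tendsto_nat_floor_mul_div_atTop ht).comp
      (tendsto_natCast_atTop_atTop.atTop_add tendsto_const_nhds)
  refine concaveOn_of_slope_anti_adjacent (convex_Ici 0) fun {x y z} hx _ hxy hyz => ?_
  have hx0 : 0 ≤ x := hx
  rw [div_le_div_iff₀ (sub_pos.2 hyz) (sub_pos.2 hxy)]
  have hy0 : 0 ≤ y := hx0.trans hxy.le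
  have hz0 : 0 ≤ z := hy0.trans hyz.le
  -- The slope inequality for the discrete sums, with the abscissae rounded down to the grid, passes
  -- to the limit.
  refine le_of_tendsto_of_tendsto'
    (((hlim2 z hz0).sub (hlim2 y hy0)).mul ((hlim3 y hy0).sub (hlim3 x hx0)))
    (((hlim2 y hy0).sub (hlim2 x hx0)).mul ((hlim3 z hz0).sub (hlim3 y hy0))) fun n => ?_
  rw [← sub_div, ← sub_div, ← mul_div_assoc, ← mul_div_assoc]
  refine div_le_div_of_nonneg_right ((hra n).sum_range_sub_mul_le (Nat.floor_le_floor ?_)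
    (Nat.floor_le_floor ?_)) (hM n).le
  · exact mul_le_mul_of_nonneg_right hxy.le (hM n).le
  · exact mul_le_mul_of_nonneg_right hyz.le (hM n).le

/-! ### Concave distribution functions and nonincreasing densities -/

/-- A half-line measure with concave distribution function is the sum of an atom at `0` and a
measure with a nonincreasing density. -/
lemma exists_density_of_concaveOn (μ : Measure ℝ) [hμ : IsHalfLineMeasure μ]
    (hc : ConcaveOn ℝ (Ici 0) fun t => μ.real (Iic t)) :
    ∃ r : ℝ → ℝ, (∀ s : ℝ, 0 < s → 0 ≤ r s) ∧ AntitoneOn r (Ioi 0) ∧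
      (∀ T : ℝ, IntegrableOn r (Ioc 0 T)) ∧
      μ = μ (Iic 0) • Measure.dirac 0 +
        (volume.restrict (Ioi 0)).withDensity (fun s => ENNReal.ofReal (r s)) := by
  set F : ℝ → ℝ := fun t => μ.real (Iic t) with hF
  have hfin : ∀ t, μ (Iic t) ≠ ⊤ := fun t => (hμ.Iic_lt_top t).ne
  have hFm : Monotone F := fun a b hab =>
    measureReal_mono (Iic_subset_Iic.2 hab) (hfin b)
  -- The density is the right derivative of `F`, which exists at every `t > 0` by concavity.
  set r : ℝ → ℝ := fun t => -derivWithin (-F) (Ioi t) t with hrdef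
  have hderiv : ∀ t, 0 < t → HasDerivWithinAt F (r t) (Ioi t) t := fun t ht => by
    have h := (hc.neg.hasDerivWithinAt_rightDeriv_of_mem_interior
      (x := t) (by rw [interior_Ici]; exact ht)).neg
    rwa [neg_neg] at h
  have hr0 : ∀ t, 0 < t → 0 ≤ r t := fun t ht => by
    rw [← (hderiv t ht).derivWithin (uniqueDiffWithinAt_Ioi t)]
    exact (hFm.monotoneOn _).derivWithin_nonneg
  have hra : AntitoneOn r (Ioi 0) := by
    have h := hc.neg.monotoneOn_rightDeriv
    rw [interior_Ici] at h
    exact h.neg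
  -- Concavity gives continuity only in the interior; at the endpoint `0` it comes from
  -- right-continuity of the distribution function.
  have hcont : ∀ T, ContinuousOn F (Icc 0 T) := by
    intro T t ht
    rcases ht.1.eq_or_lt with rfl | h
    · exact ((ENNReal.tendsto_toReal (hfin 0)).comp
        (IsHalfLineMeasure.continuousWithinAt_Iic μ 0)).mono_left
          (nhdsWithin_mono _ Icc_subset_Ici_self)
    · have h1 := hc.continuousOn_interior
      rw [interior_Ici] at h1
      exact (h1.continuousAt (Ioi_mem_nhds h)).continuousWithinAt
  have hri : ∀ T, IntegrableOn r (Ioc 0 T) := fun T =>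
    intervalIntegral.integrableOn_deriv_right_of_nonneg (hcont T) (fun x hx => hderiv x hx.1)
      fun x hx => hr0 x hx.1
  have hlint : ∀ T, 0 ≤ T → ∫⁻ s in Ioc 0 T, ENNReal.ofReal (r s) = ENNReal.ofReal (F T - F 0) := by
    intro T hT
    rw [← intervalIntegral.integral_eq_sub_of_hasDeriv_right_of_le hT (hcont T)
      (fun x hx => hderiv x hx.1) ((intervalIntegrable_iff_integrableOn_Ioc_of_le hT).2 (hri T)),
      intervalIntegral.integral_of_le hT, ofReal_integral_eq_lintegral_ofReal (hri T)]
    filter_upwards [ae_restrict_mem measurableSet_Ioc] with x hx using hr0 x hx.1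
  have hIic : ∀ T, 0 ≤ T → (μ (Iic 0) • Measure.dirac 0 +
      (volume.restrict (Ioi 0)).withDensity (fun s => ENNReal.ofReal (r s)) : Measure ℝ) (Iic T)
      = μ (Iic T) := by
    intro T hT
    rw [Measure.add_apply, withDensity_apply _ measurableSet_Iic,
      Measure.restrict_restrict measurableSet_Iic, inter_comm, Ioi_inter_Iic, hlint T hT,
      Measure.smul_apply, Measure.dirac_apply' _ measurableSet_Iic,
      indicator_of_mem (by exact hT), Pi.one_apply, smul_eq_mul, mul_one,
      ← ENNReal.ofReal_toReal (hfin 0), ← ENNReal.ofReal_toReal (hfin T)]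
    change ENNReal.ofReal (F 0) + _ = ENNReal.ofReal (F T)
    rw [← ENNReal.ofReal_add measureReal_nonneg (sub_nonneg.2 (hFm hT)), add_sub_cancel]
  refine ⟨r, hr0, hra, hri, ?_⟩
  have : IsHalfLineMeasure (μ (Iic 0) • Measure.dirac 0 +
      (volume.restrict (Ioi 0)).withDensity (fun s => ENNReal.ofReal (r s))) := by
    refine ⟨?_, fun T => ?_⟩
    · rw [Measure.add_apply, withDensity_apply _ measurableSet_Iio,
        Measure.restrict_restrict measurableSet_Iio, inter_comm, Ioi_inter_Iio]
      simp
    · refine (measure_mono (Iic_subset_Iic.2 (le_max_left T 0))).trans_lt ?_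
      rw [hIic _ (le_max_right T 0)]
      exact hμ.Iic_lt_top _
  exact IsHalfLineMeasure.ext_Iic fun T hT => (hIic T hT).symm

/-- A nonnegative measure that is the sum of an atom at `0` and a measure with a nonincreasing
density is nonincreasing. -/
lemma LocSignedMeasure.nonincreasing_of_density {R : LocSignedMeasure} (hneg : R.neg = 0)
    {c : ℝ≥0∞} {r : ℝ → ℝ} (hr : AntitoneOn r (Ioi 0))
    (hpos : R.pos = c • Measure.dirac 0 +
      (volume.restrict (Ioi 0)).withDensity (fun s => ENNReal.ofReal (r s))) :
    R.Nonincreasing := by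
  intro h₁ h₂ h0 h12 T A hA hAT
  have hm : ∀ h : ℝ, MeasurableSet ((fun s : ℝ => s - h) ⁻¹' A) := fun h =>
    (measurable_id.sub_const h) hA
  have hfin : R.pos ((fun s => s - h₁) ⁻¹' A) ≠ ⊤ :=
    ((measure_mono fun s hs => by
      have := (hAT hs).2
      simp only [mem_Iic]
      linarith).trans_lt (IsHalfLineMeasure.Iic_lt_top (μ := R.pos) (T + h₁))).ne
  simp only [eval, hneg, Measure.coe_zero, Pi.zero_apply, ENNReal.toReal_zero, sub_zero]
  refine sub_nonneg.2 (ENNReal.toReal_mono hfin ?_)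
  rcases h12.eq_or_lt with rfl | hlt
  · exact le_rfl
  -- The shift by `h₂ > 0` moves the atom out of `[0, ∞)`. It can then only contribute to the larger
  -- side, so it suffices to compare densities.
  have h2 : (0 : ℝ) ∉ (fun s => s - h₂) ⁻¹' A := fun h => by
    have := (hAT h).1
    simp only [zero_sub] at this
    linarith
  have hden : ∀ h : ℝ, ((volume.restrict (Ioi 0)).withDensity (fun s => ENNReal.ofReal (r s)))
      ((fun s => s - h) ⁻¹' A) = ∫⁻ s, A.indicator
        (fun s => (Ioi (0 : ℝ)).indicator (fun u => ENNReal.ofReal (r u)) (s + h)) s := by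
    intro h
    rw [withDensity_apply _ (hm h), Measure.restrict_restrict (hm h), inter_comm,
      ← Measure.restrict_restrict measurableSet_Ioi, ← lintegral_indicator measurableSet_Ioi,
      ← lintegral_indicator (hm h), ← lintegral_add_right_eq_self _ h]
    refine lintegral_congr fun s => ?_
    have hiff : s + h ∈ (fun s : ℝ => s - h) ⁻¹' A ↔ s ∈ A := by
      rw [mem_preimage, add_sub_cancel_right]
    by_cases hs : s ∈ A
    · rw [indicator_of_mem (hiff.2 hs), indicator_of_mem hs]
    · rw [indicator_of_notMem (mt hiff.1 hs), indicator_of_notMem hs]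
  rw [hpos, Measure.add_apply, Measure.add_apply, hden, hden, Measure.smul_apply,
    Measure.dirac_apply' _ (hm _), indicator_of_notMem h2, smul_zero, zero_add]
  refine le_add_left (lintegral_mono_ae ?_)
  -- For `h₁ = 0` the point `s = 0` falls outside `(0, ∞)`, where `r` is not controlled.
  have h0ae : ∀ᵐ s : ℝ, s ≠ 0 := by simp [ae_iff]
  filter_upwards [h0ae] with s hs
  by_cases hsA : s ∈ A
  · have hs0 : 0 < s := lt_of_le_of_ne (hAT hsA).1 hs.symm
    rw [indicator_of_mem hsA, indicator_of_mem hsA,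
      indicator_of_mem (mem_Ioi.2 (by linarith)), indicator_of_mem (mem_Ioi.2 (by linarith))]
    exact ENNReal.ofReal_le_ofReal (hr (mem_Ioi.2 (by linarith)) (mem_Ioi.2 (by linarith))
      (by linarith))
  · rw [indicator_of_notMem hsA, indicator_of_notMem hsA]

/-- The resolvent of a nonincreasing kernel that preserves nonnegativity. -/
lemma PreservesNonneg.exists_density {G : ℝ → ℝ} (hPN : PreservesNonneg G)
    (hG0 : 0 < G 0) (hGc : ContinuousWithinAt G (Ici 0) 0) (hGa : AntitoneOn G (Ici 0))
    {R : LocSignedMeasure} (hR : R.IsResolvent G) (hneg : R.neg = 0) :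
    ∃ r : ℝ → ℝ, (∀ s : ℝ, 0 < s → 0 ≤ r s) ∧ AntitoneOn r (Ioi 0) ∧
      (∀ T : ℝ, IntegrableOn r (Ioc 0 T)) ∧
      R.pos = ENNReal.ofReal (1 / G 0) • Measure.dirac 0 +
        (volume.restrict (Ioi 0)).withDensity (fun s => ENNReal.ofReal (r s)) := by
  have hone : ∀ t, 0 ≤ t → ∫ s, zeroExt G (t - s) ∂(R.pos) = 1 := fun t ht => by
    have := hR.integral_sub t
    rwa [hneg, integral_zero_measure, sub_zero, indicator_of_mem (by exact ht)] at this
  have hc := hPN.concaveOn_Iic hG0 hGc hGa R.pos hR.integrable_pos hone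
  obtain ⟨r, h1, h2, h3, h4⟩ := exists_density_of_concaveOn R.pos hc
  refine ⟨r, h1, h2, h3, ?_⟩
  have hfin : R.pos (Iic 0) ≠ ⊤ := (IsHalfLineMeasure.Iic_lt_top 0).ne
  have h0 := hone 0 le_rfl
  -- At `t = 0` the resolvent equation reads `R {0} * G 0 = 1`, which determines the atom.
  rw [integral_zeroExt, Icc_self, integral_singleton, sub_zero, smul_eq_mul] at h0
  have h5 : R.pos (Iic 0) = R.pos {0} := by
    rw [← Icc_self]
    exact (measure_congr (Icc_ae_eq_Iic R.pos 0)).symm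
  have h6 : R.pos (Iic 0) = ENNReal.ofReal (1 / G 0) := by
    rw [← ENNReal.ofReal_toReal hfin, h5]
    congr 1
    rw [eq_div_iff hG0.ne']
    exact h0
  rw [← h6]
  exact h4

/-! ### The main theorem -/

theorem theorem3 (G : ℝ → ℝ)
    (hG_nonneg : ∀ t : ℝ, 0 ≤ t → 0 ≤ G t)
    (hG_zero : 0 < G 0)
    (hG_rightCont : ∀ t : ℝ, 0 ≤ t → ContinuousWithinAt G (Ici t) t)
    (hG_locInt : LocallyIntegrableOn G (Ici 0)) :
    (∀ R : LocSignedMeasure, R.IsResolvent G → R.Nonincreasing → PreservesNonneg G) ∧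
    (AntitoneOn G (Ici 0) →
      (∃! R : LocSignedMeasure, R.IsResolvent G) ∧
      ∀ R : LocSignedMeasure, R.IsResolvent G →
        (PreservesNonneg G ↔ R.Nonincreasing) ∧
        (PreservesNonneg G →
          ∃ r : ℝ → ℝ, (∀ s : ℝ, 0 < s → 0 ≤ r s) ∧ AntitoneOn r (Ioi 0) ∧
            (∀ T : ℝ, IntegrableOn r (Ioc 0 T)) ∧
            R.neg = 0 ∧
            R.pos = ENNReal.ofReal (1 / G 0) • Measure.dirac 0 +
              (volume.restrict (Ioi 0)).withDensity (fun s => ENNReal.ofReal (r s)))) := by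
  refine ⟨fun R hR hmono => hR.preservesNonneg hmono hG_nonneg hG_rightCont hG_locInt,
    fun hGa => ?_⟩
  obtain ⟨S, hS, hSneg⟩ := exists_isResolvent_of_antitone hG_nonneg hG_zero hG_rightCont hGa
  have huniq : ∀ R : LocSignedMeasure, R.IsResolvent G → R = S := fun R hR =>
    hR.unique hS hG_nonneg (measurable_zeroExt hG_rightCont) hG_locInt
  refine ⟨⟨S, hS, huniq⟩, fun R hR => ?_⟩
  have hneg : R.neg = 0 := huniq R hR ▸ hSneg
  have hdens := fun hPN : PreservesNonneg G =>
    hPN.exists_density hG_zero (hG_rightCont 0 le_rfl) hGa hR hneg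
  refine ⟨⟨fun hPN => ?_, fun hmono =>
    hR.preservesNonneg hmono hG_nonneg hG_rightCont hG_locInt⟩, fun hPN => ?_⟩
  · obtain ⟨r, -, hr, -, hpos⟩ := hdens hPN
    exact LocSignedMeasure.nonincreasing_of_density hneg hr hpos
  · obtain ⟨r, h1, h2, h3, hpos⟩ := hdens hPN
    exact ⟨r, h1, h2, h3, hneg, hpos⟩
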